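/- Let $(M,g)$ be a smooth Riemannian manifold of dimension $3$ and let $\tilde g=e^{2f}g$, with $f\in C^\infty(M)$, be a metric in the conformal class $[g]$. Suppose that $\tilde g$ admits a smooth vector field $X$ that is parallel ($\nabla^{\tilde g}X=0$ for the Levi-Civita connection of $\tilde g$) and does not vanish identically on any connected component of $M$. Then for every $p\in M$ there is a nonzero tangent vector $v\in T_pM$ such that $$CY_p(v,v)=0\qquad\text{and}\qquad CY_p(w_1,w_2)=0\quad\text{for all } w_1,w_2\in v^{\perp}=\{w\in T_pM : g_p(v,w)=0\}.$$ Here $CY$ is the $(0,2)$ Cotton–York tensor of $g$: with the Schouten tensor $S=\mathrm{Ric}-\tfrac14 s\,g$ ($s$ the scalar curvature) and the Cotton tensor $C_{ijk}=(\nabla_iS)_{jk}-(\nabla_jS)_{ik}$, it is given in any local coordinates by $$CY_{ij}=\frac12\sum_{k,l,m}C_{kli}\,g_{jm}\,\frac{\epsilon^{klm}}{\sqrt{\det g}},$$ where $\epsilon^{klm}$ is the sign of the permutation $(k,l,m)$ of $(1,2,3)$, and $0$ if it is not a permutation. This is a tensor up to the sign given by the orientation of the coordinates, which does not affect the statement.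 -/

import Mathlib

open scoped Manifold ContDiff

noncomputable section

namespace ConformalGeom

/-- The model space `ℝⁿ`. -/
abbrev Model (n : ℕ) : Type := EuclideanSpace ℝ (Fin n)

/-! ### Riemannian geometry of a matrix-valued function on `ℝⁿ`

Here `G : ℝⁿ → Mat_n(ℝ)` is the matrix of a metric `g` in local coordinates. -/

section Local

variable {n : ℕ}

/-- The partial derivative `∂ᵢ f`. -/
def pd (i : Fin n) (f : Model n → ℝ) (x : Model n) : ℝ :=
  fderiv ℝ f x (EuclideanSpace.single i 1)

/-- Christoffel symbols: `christoffel G k i j = Γᵏᵢⱼ`. -/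
def christoffel (G : Model n → Matrix (Fin n) (Fin n) ℝ) (k i j : Fin n) (x : Model n) : ℝ :=
  (1 / 2) * ∑ l, (G x)⁻¹ k l *
    (pd i (fun y => G y j l) x + pd j (fun y => G y i l) x - pd l (fun y => G y i j) x)

/-- The `(1,3)` curvature tensor: `R(∂ᵢ, ∂ⱼ)∂ₖ = ∑ₗ (riemann G l i j k) ∂ₗ`, where
`R(X, Y)Z = ∇_X ∇_Y Z - ∇_Y ∇_X Z - ∇_[X,Y] Z`. -/
def riemann (G : Model n → Matrix (Fin n) (Fin n) ℝ) (l i j k : Fin n) (x : Model n) : ℝ :=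
  pd i (christoffel G l j k) x - pd j (christoffel G l i k) x
    + ∑ m, (christoffel G l i m x * christoffel G m j k x
      - christoffel G l j m x * christoffel G m i k x)

/-- The Ricci tensor: `Ric(Y, Z)` is the trace of `X ↦ R(X, Y)Z`. -/
def ricci (G : Model n → Matrix (Fin n) (Fin n) ℝ) (j k : Fin n) (x : Model n) : ℝ :=
  ∑ i, riemann G i i j k x

/-- The scalar curvature `s = gʲᵏ Ricⱼₖ`. -/
def scalarCurv (G : Model n → Matrix (Fin n) (Fin n) ℝ) (x : Model n) : ℝ :=
  ∑ j, ∑ k, (G x)⁻¹ j k * ricci G j k x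

/-- The Schouten tensor `S = (Ric - s g / (2 (n - 1))) / (n - 2)` (meaningful for `n ≥ 3`). -/
def schouten (G : Model n → Matrix (Fin n) (Fin n) ℝ) (j k : Fin n) (x : Model n) : ℝ :=
  (1 / ((n : ℝ) - 2)) *
    (ricci G j k x - (1 / (2 * ((n : ℝ) - 1))) * scalarCurv G x * G x j k)

/-- `(∇ₐ S)_{bc}`, the covariant derivative of the Schouten tensor. -/
def nablaSchouten (G : Model n → Matrix (Fin n) (Fin n) ℝ) (a b c : Fin n) (x : Model n) : ℝ :=
  pd a (schouten G b c) x - ∑ m, christoffel G m a b x * schouten G m c x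
    - ∑ m, christoffel G m a c x * schouten G b m x

/-- The Cotton tensor `C_{ijk} = (∇ᵢ S)_{jk} - (∇ⱼ S)_{ik}`. -/
def cotton (G : Model n → Matrix (Fin n) (Fin n) ℝ) (i j k : Fin n) (x : Model n) : ℝ :=
  nablaSchouten G i j k x - nablaSchouten G j i k x

/-- The `(0,2)` Cotton–York tensor in dimension three,
`CY_{ij} = (1/2) C_{kli} g_{jm} ε^{klm} / √(det g)`. Only those `(k, l, m)` that form a permutation
of the three indices contribute, so the sum is taken over permutations. -/
def cottonYorkCoeff (G : Model 3 → Matrix (Fin 3) (Fin 3) ℝ) (i j : Fin 3) (x : Model 3) : ℝ :=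
  (1 / 2) * ∑ σ : Equiv.Perm (Fin 3),
    cotton G (σ 0) (σ 1) i x * G x j (σ 2) * ((Equiv.Perm.sign σ : ℤ) : ℝ) / √(G x).det

end Local

/-! ### Riemannian metrics on manifolds, read in charts -/

section Global

variable {n : ℕ} {M : Type*} [TopologicalSpace M] [ChartedSpace (Model n) M]

/-- The coordinate vector field `∂ᵢ` of the chart `e`, at the point with coordinates `x`. -/
def coordVec (e : OpenPartialHomeomorph M (Model n)) (x : Model n) (i : Fin n) :
    TangentSpace 𝓘(ℝ, Model n) (e.symm x) :=
  mfderiv 𝓘(ℝ, Model n) 𝓘(ℝ, Model n) e.symm x (EuclideanSpace.single i (1 : ℝ) : Model n)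

/-- The components `vⁱ = dxⁱ(v)` of a tangent vector in the chart `e`. -/
def coordOf (e : OpenPartialHomeomorph M (Model n)) (p : M) (v : TangentSpace 𝓘(ℝ, Model n) p) :
    Model n :=
  mfderiv 𝓘(ℝ, Model n) 𝓘(ℝ, Model n) e p v

variable [IsManifold 𝓘(ℝ, Model n) ∞ M]

variable (n M) in
/-- A smooth Riemannian metric on the tangent bundle of `M`. -/
abbrev SmoothMetric : Type _ :=
  Bundle.ContMDiffRiemannianMetric 𝓘(ℝ, Model n) ∞ (Model n)
    (fun p : M => TangentSpace 𝓘(ℝ, Model n) p)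

/-- The matrix `gᵢⱼ = g(∂ᵢ, ∂ⱼ)` of the metric in the chart `e`, as a function of the
coordinates. -/
def metricMatrix (g : SmoothMetric n M) (e : OpenPartialHomeomorph M (Model n)) (x : Model n) :
    Matrix (Fin n) (Fin n) ℝ :=
  Matrix.of fun i j => g.inner (e.symm x) (coordVec e x i) (coordVec e x j)

/-- `g' ∈ [g]`: there is a smooth function `f` with `g' = e^{2f} g`. -/
def IsConformal (g g' : SmoothMetric n M) : Prop :=
  ∃ f : M → ℝ, ContMDiff 𝓘(ℝ, Model n) 𝓘(ℝ, ℝ) ∞ f ∧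
    ∀ (p : M) (v w : TangentSpace 𝓘(ℝ, Model n) p),
      g'.inner p v w = Real.exp (2 * f p) * g.inner p v w

/-- `X` is a smooth vector field with `∇X = 0` for the Levi-Civita connection of `g`: in every
smooth chart, `∂ᵢ Xᵏ + Γᵏᵢⱼ Xʲ = 0`. -/
def IsParallel (g : SmoothMetric n M) (X : ∀ p : M, TangentSpace 𝓘(ℝ, Model n) p) : Prop :=
  ContMDiff 𝓘(ℝ, Model n) 𝓘(ℝ, Model n).tangent ∞
    (fun p => (⟨p, X p⟩ : TangentBundle 𝓘(ℝ, Model n) M)) ∧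
  ∀ e ∈ IsManifold.maximalAtlas 𝓘(ℝ, Model n) ∞ M, ∀ x ∈ e.target, ∀ i k : Fin n,
    pd i (fun y => coordOf e (e.symm y) (X (e.symm y)) k) x
      + ∑ j, christoffel (metricMatrix g e) k i j x * coordOf e (e.symm x) (X (e.symm x)) j = 0

end Global

/-- `CY_p(v, w)` for the metric `g` on a 3-manifold, computed in the chart `e` around `p` and with
respect to the orientation given by `e`; charts of opposite orientation give the opposite sign. -/
def cottonYork {M : Type*} [TopologicalSpace M] [ChartedSpace (Model 3) M]
    [IsManifold 𝓘(ℝ, Model 3) ∞ M] (g : SmoothMetric 3 M) (e : OpenPartialHomeomorph M (Model 3))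
    (p : M) (v w : TangentSpace 𝓘(ℝ, Model 3) p) : ℝ :=
  ∑ i, ∑ j, cottonYorkCoeff (metricMatrix g e) i j (e p) * coordOf e p v i * coordOf e p w j

end ConformalGeom

end

/-! Write `h` for the rescaled metric carrying the parallel field `X`, `ξ = h X` and `c = h(X, X)`.
A parallel field has locally constant length, so `X` vanishes nowhere, and `v = X p` is the required
vector.

Curvature of `h` annihilates `X`. In dimension three an antisymmetric index pair is a vector, so the
lowered curvature is a multiple of `X ⊗ X` (`curvature_rank_one`). Equivalently, it is the
Kulkarni–Nomizu product of `h` with `K (h/2 - ξ ⊗ ξ / c)` for a single function `K`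
(`exists_curv_eq_kulkarni`). Since `h`, `ξ` and `c` are covariantly constant, the Cotton tensor is
`dK` wedged with `h/2 - ξ ⊗ ξ / c` (`covExt_splitForm`), and the second Bianchi identity gives `X K
= 0` (`deriv_along_parallel`).

The Cotton tensor is conformally invariant when the curvature is a Kulkarni–Nomizu product
(`covExt_conformal`), so the same formula holds for the original metric (`exists_covExt_schForm`).
Inserting `X` in the last slot gives `-(1/2) dK ∧ ξ`, and wedging with a multiple of `ξ` gives zero.
Inserting `w₁ ⊥ X` gives `(1/2) dK ∧ h w₁`; its wedge with a multiple of `h w₂`, `w₂ ⊥ X`, is a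
3-form made of covectors that all annihilate `X`, hence zero (`cottonYorkCoeff_vanishing`).

The tensor calculus is carried out over a commutative ring with commuting derivations, where each
identity becomes ring algebra, and is then specialised to smooth functions on a chart domain. -/

noncomputable section

namespace ConformalGeom

/-! ### Connections over a commutative ring with commuting derivations -/

section Algebraic

open Matrix

set_option linter.unusedSectionVars false

variable {ι A : Type*} [Fintype ι] [DecidableEq ι] [CommRing A] [Algebra ℝ A]

/-- A derivation applied to the entries of a vector. -/
def vecDeriv (d : Derivation ℝ A A) (v : ι → A) : ι → A := fun k => d (v k)

/-- A derivation applied to the entries of a matrix. -/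
def matDeriv (d : Derivation ℝ A A) (M : Matrix ι ι A) : Matrix ι ι A := of fun k l => d (M k l)

section Leibniz

variable (d : Derivation ℝ A A)

lemma matDeriv_add (M N : Matrix ι ι A) : matDeriv d (M + N) = matDeriv d M + matDeriv d N := by
  ext; simp [matDeriv]

lemma matDeriv_sub (M N : Matrix ι ι A) : matDeriv d (M - N) = matDeriv d M - matDeriv d N := by
  ext; simp [matDeriv]

lemma matDeriv_transpose (M : Matrix ι ι A) : matDeriv d Mᵀ = (matDeriv d M)ᵀ := by
  ext; simp [matDeriv]

lemma matDeriv_smul (a : A) (M : Matrix ι ι A) :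
    matDeriv d (a • M) = d a • M + a • matDeriv d M := by
  ext; simp [matDeriv]; ring

lemma matDeriv_one : matDeriv d (1 : Matrix ι ι A) = 0 := by
  ext i j; by_cases h : i = j <;> simp [matDeriv, h]

lemma matDeriv_mul (M N : Matrix ι ι A) :
    matDeriv d (M * N) = matDeriv d M * N + M * matDeriv d N := by
  ext i j
  simp only [matDeriv, Matrix.mul_apply, of_apply, map_sum, Derivation.leibniz, smul_eq_mul,
    Matrix.add_apply, ← Finset.sum_add_distrib]
  exact Finset.sum_congr rfl fun k _ => by ring

lemma matDeriv_vecMulVec (v w : ι → A) :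
    matDeriv d (vecMulVec v w) = vecMulVec (vecDeriv d v) w + vecMulVec v (vecDeriv d w) := by
  ext; simp [matDeriv, vecDeriv, vecMulVec_apply]; ring

lemma vecDeriv_mulVec (M : Matrix ι ι A) (v : ι → A) :
    vecDeriv d (M *ᵥ v) = matDeriv d M *ᵥ v + M *ᵥ vecDeriv d v := by
  ext i
  simp only [vecDeriv, matDeriv, mulVec, dotProduct, of_apply, map_sum, Derivation.leibniz,
    smul_eq_mul, Pi.add_apply, ← Finset.sum_add_distrib]
  exact Finset.sum_congr rfl fun k _ => by ring

lemma vecDeriv_vecMul (M : Matrix ι ι A) (v : ι → A) :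
    vecDeriv d (v ᵥ* M) = vecDeriv d v ᵥ* M + v ᵥ* matDeriv d M := by
  ext i
  simp only [vecDeriv, matDeriv, vecMul, dotProduct, of_apply, map_sum, Derivation.leibniz,
    smul_eq_mul, Pi.add_apply, ← Finset.sum_add_distrib]
  exact Finset.sum_congr rfl fun k _ => by ring

lemma deriv_dotProduct (v w : ι → A) :
    d (v ⬝ᵥ w) = vecDeriv d v ⬝ᵥ w + v ⬝ᵥ vecDeriv d w := by
  simp only [vecDeriv, dotProduct, map_sum, Derivation.leibniz,
    smul_eq_mul, ← Finset.sum_add_distrib]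
  exact Finset.sum_congr rfl fun k _ => by ring

lemma vecDeriv_add (v w : ι → A) : vecDeriv d (v + w) = vecDeriv d v + vecDeriv d w := by
  ext; simp [vecDeriv]

lemma vecDeriv_sub (v w : ι → A) : vecDeriv d (v - w) = vecDeriv d v - vecDeriv d w := by
  ext; simp [vecDeriv]

lemma vecDeriv_smul (a : A) (v : ι → A) : vecDeriv d (a • v) = d a • v + a • vecDeriv d v := by
  ext; simp [vecDeriv]; ring

lemma vecDeriv_single (i : ι) : vecDeriv d (Pi.single i (1 : A)) = 0 := by
  ext k; by_cases h : k = i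
  · subst h; simp [vecDeriv]
  · simp [vecDeriv, h]

end Leibniz

/-- The curvature `R_{ij} = ∂ᵢΓⱼ - ∂ⱼΓᵢ + [Γᵢ, Γⱼ]` of the connection with matrices `Γᵢ`. -/
def curv (D : ι → Derivation ℝ A A) (Γ : ι → Matrix ι ι A) (i j : ι) : Matrix ι ι A :=
  matDeriv (D i) (Γ j) - matDeriv (D j) (Γ i) + (Γ i * Γ j - Γ j * Γ i)

/-- The scalar `1 / 2`. -/
def half (A : Type*) [CommRing A] [Algebra ℝ A] : A := algebraMap ℝ A (1 / 2)

lemma two_mul_half : 2 * half A = 1 := by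
  have : (2 : A) = algebraMap ℝ A 2 := (map_ofNat (algebraMap ℝ A) 2).symm
  rw [half, this, ← map_mul]; norm_num

/-- The connection matrices `(Γᵢ)ₖⱼ = Γᵏᵢⱼ` of the metric `h` with inverse `u`. -/
def levi (D : ι → Derivation ℝ A A) (u h : Matrix ι ι A) (i : ι) : Matrix ι ι A :=
  of fun k j => half A * ∑ l, u k l * (D i (h j l) + D j (h i l) - D l (h i j))

/-- The connection matrices `Γ` are metric for `h` and torsion-free. -/
structure IsLevi (D : ι → Derivation ℝ A A) (h : Matrix ι ι A) (Γ : ι → Matrix ι ι A) : Prop where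
  symm : hᵀ = h
  comm : ∀ i j a, D i (D j a) = D j (D i a)
  compat : ∀ i, matDeriv (D i) h = h * Γ i + (Γ i)ᵀ * h
  torsion : ∀ i j k, Γ i k j = Γ j k i

variable {D : ι → Derivation ℝ A A} {h u : Matrix ι ι A} {Γ : ι → Matrix ι ι A}

/-- Lowering the upper index with `h` turns the definition into the Koszul formula, from which
compatibility follows by adding its transpose. -/
lemma isLevi_levi (hs : hᵀ = h) (hc : ∀ i j a, D i (D j a) = D j (D i a)) (hu : h * u = 1) :
    IsLevi D h (levi D u h) := by
  have hs' : ∀ i j, h i j = h j i := fun i j => congrFun (congrFun hs j) i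
  have key : ∀ i l j, (h * levi D u h i) l j
      = half A * (D i (h j l) + D j (h i l) - D l (h i j)) := by
    intro i l j
    have : levi D u h i = half A • (u * of fun l j => D i (h j l) + D j (h i l) - D l (h i j)) := by
      ext k j; simp [levi, Matrix.mul_apply]
    rw [this, Matrix.mul_smul, ← Matrix.mul_assoc, hu, Matrix.one_mul]; simp
  refine ⟨hs, hc, fun i => ?_, fun i j k => ?_⟩
  · have hT : (levi D u h i)ᵀ * h = (h * levi D u h i)ᵀ := by rw [transpose_mul, hs]
    ext l j
    rw [hT, Matrix.add_apply, transpose_apply, key, key]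
    simp only [matDeriv, of_apply]
    rw [hs' j l, hs' i l, hs' i j]
    linear_combination (-D i (h l j)) * two_mul_half (A := A)
  · simp only [levi, of_apply]
    congr 1
    refine Finset.sum_congr rfl fun l _ => ?_
    rw [hs' i j]; ring

/-- The Levi-Civita connection of a conformally rescaled metric. -/
lemma levi_conformal (hs : hᵀ = h) (hu : u * h = 1) {w wi : A} (hw : w * wi = 1) {φ : A}
    (hφ : ∀ i, D i w = 2 * w * D i φ) (i : ι) :
    levi D (wi • u) (w • h) i = levi D u h i + (D i φ • (1 : Matrix ι ι A)
      + vecMulVec (Pi.single i 1) (fun j => D j φ)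
      - vecMulVec (u *ᵥ fun j => D j φ) (h i)) := by
  ext k j
  have hs' : ∀ i j, h i j = h j i := fun i j => congrFun (congrFun hs j) i
  have h1 : ∀ a, ∑ l, u k l * h a l = (1 : Matrix ι ι A) k a := fun a => by
    rw [← hu, Matrix.mul_apply]
    exact Finset.sum_congr rfl fun l _ => by rw [hs' a l]
  have h2 : ∑ l, (wi • u) k l * (D i ((w • h) j l) + D j ((w • h) i l) - D l ((w • h) i j))
      = ∑ l, u k l * (D i (h j l) + D j (h i l) - D l (h i j))
        + 2 * (D i φ * ∑ l, u k l * h j l + D j φ * ∑ l, u k l * h i l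
          - (∑ l, u k l * D l φ) * h i j) := by
    simp only [Finset.mul_sum, Finset.sum_mul, ← Finset.sum_add_distrib,
      ← Finset.sum_sub_distrib]
    refine Finset.sum_congr rfl fun l _ => ?_
    simp only [Matrix.smul_apply, smul_eq_mul, Derivation.leibniz, hφ]
    linear_combination (u k l * (D i (h j l) + D j (h i l) - D l (h i j))
      + 2 * (D i φ * (u k l * h j l) + D j φ * (u k l * h i l) - u k l * D l φ * h i j)) * hw
  have h3 : (1 : Matrix ι ι A) k i = Pi.single (M := fun _ => A) i 1 k := by
    rw [Matrix.one_apply, Pi.single_apply]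
  simp only [levi, of_apply, Matrix.add_apply _ (_ + _ - _)]
  rw [h2, h1, h1, h3]
  simp only [Matrix.add_apply, Matrix.sub_apply, Matrix.smul_apply,
    smul_eq_mul, vecMulVec_apply, mulVec, dotProduct]
  linear_combination (D i φ * (1 : Matrix ι ι A) k j
    + D j φ * Pi.single (M := fun _ => A) i 1 k
    - (∑ l, u k l * D l φ) * h i j) * two_mul_half (A := A)

lemma matDeriv_comm (H : IsLevi D h Γ) (i j : ι) (M : Matrix ι ι A) :
    matDeriv (D i) (matDeriv (D j) M) = matDeriv (D j) (matDeriv (D i) M) := by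
  ext; simp [matDeriv, H.comm i j]

lemma vecDeriv_comm (H : IsLevi D h Γ) (i j : ι) (v : ι → A) :
    vecDeriv (D i) (vecDeriv (D j) v) = vecDeriv (D j) (vecDeriv (D i) v) := by
  ext; simp [vecDeriv, H.comm i j]

lemma curv_swap (i j : ι) : curv D Γ i j = - curv D Γ j i := by
  simp only [curv]; abel

/-- Second derivatives of `h` commute; expanding both orders through metric compatibility leaves the
antisymmetry of the lowered curvature. -/
lemma curv_metric (H : IsLevi D h Γ) (i j : ι) :
    h * curv D Γ i j + (curv D Γ i j)ᵀ * h = 0 := by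
  have := matDeriv_comm H i j h
  rw [H.compat, H.compat, matDeriv_add, matDeriv_add, matDeriv_mul, matDeriv_mul, matDeriv_mul,
    matDeriv_mul, matDeriv_transpose, matDeriv_transpose, H.compat, H.compat] at this
  rw [← sub_eq_zero] at this
  rw [← this]
  simp only [curv, transpose_add, transpose_sub, transpose_mul]
  noncomm_ring

lemma curv_bianchi₁ (H : IsLevi D h Γ) (i j k l : ι) :
    curv D Γ i j l k + curv D Γ j k l i + curv D Γ k i l j = 0 := by
  have hm : ∀ a b c, (Γ a * Γ b) l c = (Γ a * Γ c) l b := fun a b c => by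
    simp only [Matrix.mul_apply]
    exact Finset.sum_congr rfl fun m _ => by rw [H.torsion b c m]
  simp only [curv, matDeriv, Matrix.add_apply, Matrix.sub_apply, of_apply]
  rw [H.torsion j k, H.torsion i k, H.torsion i j, hm i j k, hm j k i, hm k i j]
  ring

/-- This is the Jacobi identity for the operators `∂ₐ + Γₐ`; once derivations commute it is a
noncommutative polynomial identity. -/
lemma curv_bianchi₂ (H : IsLevi D h Γ) (a i j : ι) :
    (matDeriv (D a) (curv D Γ i j) + (Γ a * curv D Γ i j - curv D Γ i j * Γ a))
    + (matDeriv (D i) (curv D Γ j a) + (Γ i * curv D Γ j a - curv D Γ j a * Γ i))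
    + (matDeriv (D j) (curv D Γ a i) + (Γ j * curv D Γ a i - curv D Γ a i * Γ j)) = 0 := by
  simp only [curv, matDeriv_add, matDeriv_sub, matDeriv_mul]
  rw [matDeriv_comm H a i, matDeriv_comm H a j, matDeriv_comm H i j]
  noncomm_ring

lemma curv_mulVec_parallel (H : IsLevi D h Γ) {X : ι → A}
    (hX : ∀ i, vecDeriv (D i) X = - (Γ i *ᵥ X)) (i j : ι) : curv D Γ i j *ᵥ X = 0 := by
  have := vecDeriv_comm H i j X
  simp only [hX, ← neg_mulVec] at this
  rw [vecDeriv_mulVec, vecDeriv_mulVec, hX, hX] at this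
  have hn : ∀ (d : Derivation ℝ A A) (M : Matrix ι ι A), matDeriv d (-M) = - matDeriv d M :=
    fun d M => by ext; simp [matDeriv]
  rw [hn, hn, ← sub_eq_zero] at this
  rw [← neg_eq_zero, ← this]
  simp only [curv, add_mulVec, sub_mulVec, neg_mulVec, mulVec_neg, mulVec_mulVec,
    Matrix.neg_mul]
  abel

end Algebraic

/-! ### Conformal change of curvature and of the Cotton tensor. -/

section Conformal

open Matrix

set_option linter.unusedSectionVars false

variable {ι A : Type*} [Fintype ι] [DecidableEq ι] [CommRing A] [Algebra ℝ A]
variable {D : ι → Derivation ℝ A A} {h u : Matrix ι ι A} {Γ : ι → Matrix ι ι A}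

/-- The difference tensor between the Levi-Civita connections of `e^{2φ} h` and `h`. -/
def confDiff (D : ι → Derivation ℝ A A) (u h : Matrix ι ι A) (φ : A) (i : ι) : Matrix ι ι A :=
  D i φ • (1 : Matrix ι ι A) + vecMulVec (Pi.single i 1) (fun j => D j φ)
      - vecMulVec (u *ᵥ fun j => D j φ) (h i)

/-- The rows of the Hessian of `φ`. -/
def hess (D : ι → Derivation ℝ A A) (Γ : ι → Matrix ι ι A) (φ : A) (i : ι) : ι → A :=
  vecDeriv (D i) (fun j => D j φ) - (fun j => D j φ) ᵥ* Γ i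

/-- The rows of the tensor `∇dφ - dφ ⊗ dφ + |dφ|² h / 2`. -/
def confSchouten (D : ι → Derivation ℝ A A) (u h : Matrix ι ι A) (Γ : ι → Matrix ι ι A) (φ : A)
    (i : ι) : ι → A :=
  hess D Γ φ i - D i φ • (fun j => D j φ)
    + (half A * ((fun j => D j φ) ⬝ᵥ (u *ᵥ fun j => D j φ))) • h i

/-- The Kulkarni–Nomizu product of `h` with the bilinear form with rows `Q i`. -/
def kulkarni (u h : Matrix ι ι A) (Q : ι → ι → A) (i j : ι) : Matrix ι ι A :=
  vecMulVec (Pi.single i 1) (Q j) - vecMulVec (Pi.single j 1) (Q i)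
    + (vecMulVec (u *ᵥ Q i) (h j) - vecMulVec (u *ᵥ Q j) (h i))

lemma vecDeriv_grad (φ : A) (i : ι) :
    vecDeriv (D i) (fun j => D j φ) = hess D Γ φ i + (fun j => D j φ) ᵥ* Γ i := by
  simp [hess]

lemma vecDeriv_row (H : IsLevi D h Γ) (i j : ι) :
    vecDeriv (D i) (h j) = h j ᵥ* Γ i + (Γ i *ᵥ Pi.single j 1) ᵥ* h := by
  ext k
  have := congrFun (congrFun (H.compat i) j) k
  simpa [matDeriv, vecDeriv, Matrix.mul_apply, vecMul, dotProduct] using this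

lemma mulVec_single_comm (H : IsLevi D h Γ) (i j : ι) :
    Γ i *ᵥ Pi.single j 1 = Γ j *ᵥ Pi.single i 1 := by
  ext k; simp [H.torsion i j k]

/-- Raising an index commutes with covariant differentiation. Differentiating `h (u p) = p` avoids
computing the derivative of the inverse metric. -/
lemma vecDeriv_sharp (H : IsLevi D h Γ) (hu : h * u = 1) (φ : A) (i : ι) :
    vecDeriv (D i) (u *ᵥ fun j => D j φ)
      = u *ᵥ hess D Γ φ i - Γ i *ᵥ (u *ᵥ fun j => D j φ) := by
  have hu' : u * h = 1 := mul_eq_one_comm.mp hu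
  set p : ι → A := fun j => D j φ with hp
  have h1 : h *ᵥ (u *ᵥ p) = p := by rw [mulVec_mulVec, hu, one_mulVec]
  have h2 := congrArg (vecDeriv (D i)) h1
  rw [vecDeriv_mulVec, H.compat, add_mulVec, ← mulVec_mulVec, ← mulVec_mulVec, h1,
    mulVec_transpose, hp, vecDeriv_grad (Γ := Γ) φ i] at h2
  have h3 : h *ᵥ vecDeriv (D i) (u *ᵥ p) = hess D Γ φ i - h *ᵥ (Γ i *ᵥ (u *ᵥ p)) := by
    rw [eq_sub_iff_add_eq, ← add_right_cancel_iff (a := p ᵥ* Γ i), ← h2]; abel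
  have h4 := congrArg (u *ᵥ ·) h3
  simpa [mulVec_mulVec, mulVec_sub, ← Matrix.mul_assoc, hu'] using h4

lemma sharp_dotProduct (H : IsLevi D h Γ) (hu : h * u = 1) (a b : ι → A) :
    a ⬝ᵥ (u *ᵥ b) = b ⬝ᵥ (u *ᵥ a) := by
  have hu' : u * h = 1 := mul_eq_one_comm.mp hu
  have : uᵀ = u := by
    have h1 := congrArg transpose hu
    rw [transpose_mul, H.symm, transpose_one] at h1
    calc uᵀ = uᵀ * (h * u) := by rw [hu, Matrix.mul_one]
      _ = u := by rw [← Matrix.mul_assoc, h1, Matrix.one_mul]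
  rw [dotProduct_mulVec, dotProduct_comm, ← mulVec_transpose, this]

lemma row_dotProduct_sharp (hu : h * u = 1) (a : ι → A) (i : ι) :
    h i ⬝ᵥ (u *ᵥ a) = a i := by
  have : (h *ᵥ (u *ᵥ a)) i = a i := by rw [mulVec_mulVec, hu, one_mulVec]
  exact this

lemma sharp_row (H : IsLevi D h Γ) (hu : h * u = 1) (i : ι) : u *ᵥ h i = Pi.single i 1 := by
  have : h i = h *ᵥ Pi.single i 1 := by
    ext k; simp; exact congrFun (congrFun H.symm k) i
  rw [this, mulVec_mulVec, mul_eq_one_comm.mp hu, one_mulVec]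

/-- The curvature of a conformally rescaled metric. -/
lemma curv_conformal (H : IsLevi D h Γ) (hu : h * u = 1) (φ : A) (i j : ι) :
    curv D (fun i => Γ i + confDiff D u h φ i) i j
      = curv D Γ i j - kulkarni u h (confSchouten D u h Γ φ) i j := by
  have hs : h i j = h j i := congrFun (congrFun H.symm j) i
  have e1 := vecDeriv_grad (D := D) (Γ := Γ) φ
  have e2 := vecDeriv_sharp H hu φ
  have e3 := row_dotProduct_sharp hu (fun j => D j φ)
  set p : ι → A := fun j => D j φ with hp
  have hp' : ∀ i, D i φ = p i := fun i => rfl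
  set q := u *ᵥ p with hq
  have hpe : ∀ i, p ⬝ᵥ (Pi.single i 1) = p i := fun i => by simp
  have hhe : ∀ i j, h i ⬝ᵥ (Pi.single j 1) = h i j := fun i j => by simp
  have hij : D i (p j) = D j (p i) := H.comm i j φ
  have ht := two_mul_half (A := A)
  simp only [curv, confDiff, ← hq, hp', matDeriv_add, matDeriv_sub, matDeriv_smul,
    matDeriv_one, matDeriv_vecMulVec, vecDeriv_single, e1, e2, vecDeriv_row H, Matrix.mul_add,
    Matrix.add_mul, Matrix.mul_sub, Matrix.sub_mul, Matrix.mul_smul, Matrix.smul_mul,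
    Matrix.mul_one, Matrix.one_mul, mul_vecMulVec (Γ _), vecMulVec_mul _ _ (Γ _),
    vecMulVec_mul_vecMulVec, hpe, hhe, e3, mulVec_single_comm H j i, kulkarni, confSchouten,
    mulVec_add, mulVec_sub, mulVec_smul, sharp_row H hu]
  ext k l
  simp only [Matrix.add_apply, Matrix.sub_apply, Matrix.smul_apply, vecMulVec_apply, hs, hij,
    Pi.add_apply, Pi.sub_apply, Pi.smul_apply, Pi.zero_apply, Matrix.zero_apply, smul_eq_mul]
  linear_combination (p ⬝ᵥ q) * (Pi.single (M := fun _ => A) i 1 k * h j l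
    - Pi.single (M := fun _ => A) j 1 k * h i l) * ht

/-- The exterior covariant derivative of a bilinear form with rows `Q i`. -/
def covExt (D : ι → Derivation ℝ A A) (Γ : ι → Matrix ι ι A) (Q : ι → ι → A) (i j : ι) : ι → A :=
  vecDeriv (D i) (Q j) - vecDeriv (D j) (Q i) - Q j ᵥ* Γ i + Q i ᵥ* Γ j

lemma hess_symm (H : IsLevi D h Γ) (φ : A) (i j : ι) : hess D Γ φ i j = hess D Γ φ j i := by
  simp only [hess, vecDeriv, Pi.sub_apply, vecMul, dotProduct, H.comm i j φ]
  congr 1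
  exact Finset.sum_congr rfl fun k _ => by rw [H.torsion i j k]

lemma confSchouten_symm (H : IsLevi D h Γ) (φ : A) (i j : ι) :
    confSchouten D u h Γ φ i j = confSchouten D u h Γ φ j i := by
  have hs : h i j = h j i := congrFun (congrFun H.symm j) i
  simp only [confSchouten, Pi.add_apply, Pi.sub_apply, Pi.smul_apply, smul_eq_mul, hs,
    hess_symm H φ i j]
  ring

/-- The Ricci identity for the covector `dφ`. -/
lemma covExt_hess (H : IsLevi D h Γ) (φ : A) (i j : ι) :
    covExt D Γ (hess D Γ φ) i j = - ((fun j => D j φ) ᵥ* curv D Γ i j) := by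
  simp only [covExt, curv, vecMul_add, vecMul_sub, ← vecMul_vecMul]
  rw [hess, hess]
  simp only [vecDeriv_sub, vecDeriv_vecMul, vecDeriv_comm H j i, sub_vecMul]
  abel

lemma deriv_normSq (H : IsLevi D h Γ) (hu : h * u = 1) (φ : A) (i : ι) :
    D i ((fun j => D j φ) ⬝ᵥ (u *ᵥ fun j => D j φ))
      = 2 * (hess D Γ φ i ⬝ᵥ (u *ᵥ fun j => D j φ)) := by
  rw [deriv_dotProduct, vecDeriv_grad (Γ := Γ), vecDeriv_sharp H hu, add_dotProduct,
    dotProduct_sub, ← dotProduct_mulVec, sharp_dotProduct H hu _ (hess D Γ φ i)]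
  ring

lemma deriv_half (d : Derivation ℝ A A) : d (half A) = 0 := d.map_algebraMap _

lemma covExt_sub (P Q : ι → ι → A) (i j : ι) :
    covExt D Γ (fun i => P i - Q i) i j = covExt D Γ P i j - covExt D Γ Q i j := by
  simp only [covExt, vecDeriv_sub, sub_vecMul]; abel

/-- The Hessian contributes the curvature term by `covExt_hess`; the derivatives of `dφ ⊗ dφ` and
`|dφ|² h / 2` regroup into `dφ` contracted with the Kulkarni–Nomizu product. -/
lemma covExt_confSchouten (H : IsLevi D h Γ) (hu : h * u = 1) (φ : A) (i j : ι) :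
    covExt D Γ (confSchouten D u h Γ φ) i j
      = - ((fun j => D j φ) ᵥ* curv D Γ i j)
        + (fun j => D j φ) ᵥ* kulkarni u h (confSchouten D u h Γ φ) i j := by
  rw [← covExt_hess H]
  have e1 := vecDeriv_grad (D := D) (Γ := Γ) φ
  have e3 := row_dotProduct_sharp hu (fun j => D j φ)
  have e4 := deriv_normSq H hu φ
  have e5 := fun i => sharp_dotProduct H hu (fun j => D j φ) (hess D Γ φ i)
  set p : ι → A := fun j => D j φ with hp
  have hp' : ∀ i, D i φ = p i := fun i => rfl
  set q := u *ᵥ p with hq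
  have hij : D i (p j) = D j (p i) := H.comm i j φ
  have hpe : ∀ i, p ⬝ᵥ (Pi.single i 1) = p i := fun i => by simp
  have ht := two_mul_half (A := A)
  simp only [covExt, confSchouten, kulkarni, ← hq, hp', vecDeriv_add, vecDeriv_sub, vecDeriv_smul,
    Derivation.leibniz, deriv_half, vecMul_add, vecMul_sub, vecMul_vecMulVec, add_vecMul,
    sub_vecMul, smul_vecMul, vecDeriv_row H, e1, e4, e5, hpe, mulVec_single_comm H j i,
    mulVec_add, mulVec_sub, mulVec_smul, sharp_row H hu, dotProduct_add, dotProduct_sub,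
    dotProduct_smul]
  ext k
  simp only [Pi.add_apply, Pi.sub_apply, Pi.smul_apply, smul_eq_mul, hij]
  linear_combination (p j * (p ⬝ᵥ q) * h i k + (hess D Γ φ i ⬝ᵥ q) * h j k
    - p i * (p ⬝ᵥ q) * h j k - (hess D Γ φ j ⬝ᵥ q) * h i k) * ht

lemma kulkarni_sub (P Q : ι → ι → A) (i j : ι) :
    kulkarni u h (fun i => P i - Q i) i j = kulkarni u h P i j - kulkarni u h Q i j := by
  simp only [kulkarni, mulVec_sub, sub_vecMulVec, vecMulVec_sub]
  abel

/-- In the absence of a Weyl tensor, the Cotton tensor is conformally invariant. -/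
lemma covExt_conformal (H : IsLevi D h Γ) (hu : h * u = 1) (φ : A) {P : ι → ι → A}
    (hP : ∀ i j, P i j = P j i) (hR : ∀ i j, curv D Γ i j = kulkarni u h P i j) (i j : ι) :
    covExt D (fun i => Γ i + confDiff D u h φ i) (fun i => P i - confSchouten D u h Γ φ i) i j
      = covExt D Γ P i j := by
  -- Effect of changing only the connection; the symmetry of the bilinear form cancels one of the
  -- correction terms.
  have h1 : covExt D (fun i => Γ i + confDiff D u h φ i)
      (fun i => P i - confSchouten D u h Γ φ i) i j
      = covExt D Γ (fun i => P i - confSchouten D u h Γ φ i) i j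
        - (fun j => D j φ) ᵥ* kulkarni u h (fun i => P i - confSchouten D u h Γ φ i) i j := by
    have hQ : (P i - confSchouten D u h Γ φ i) j = (P j - confSchouten D u h Γ φ j) i := by
      simp only [Pi.sub_apply, hP i j, confSchouten_symm H φ i j]
    simp only [covExt, kulkarni]
    generalize P i - confSchouten D u h Γ φ i = Qi at *
    generalize P j - confSchouten D u h Γ φ j = Qj at *
    have hpe : ∀ i (a : ι → A), a ⬝ᵥ (Pi.single i 1) = a i := fun i => by simp
    have e5 := fun a => sharp_dotProduct H hu (fun j => D j φ) a
    simp only [confDiff, vecMul_add, vecMul_sub, vecMul_vecMulVec, hpe, e5, hQ, vecMul_smul,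
      vecMul_one]
    abel
  -- The corrections from the connection and from the Schouten tensor cancel exactly because the
  -- curvature is the Kulkarni–Nomizu product of `P`.
  rw [h1, kulkarni_sub, ← hR, covExt_sub, covExt_confSchouten H hu, vecMul_sub]
  abel

/-- The Ricci contraction. In dimension three the coefficient of `Q` is `1`, which lets `Q` be
recovered as the Schouten tensor. -/
lemma sum_kulkarni (H : IsLevi D h Γ) (hu : h * u = 1) (Q : ι → ι → A) (j k : ι) :
    ∑ i, kulkarni u h Q i j i k
      = ((Fintype.card ι : A) - 2) * Q j k + (∑ a, ∑ b, u a b * Q a b) * h j k := by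
  have h1 : ∑ i, (u *ᵥ Q j) i * h i k = Q j k := by
    have := row_dotProduct_sharp hu (Q j) k
    rw [← this, dotProduct]
    refine Finset.sum_congr rfl fun i _ => ?_
    rw [mul_comm, ← congrFun (congrFun H.symm i) k]; rfl
  simp only [kulkarni, Matrix.add_apply, Matrix.sub_apply, vecMulVec_apply,
    Finset.sum_add_distrib, Finset.sum_sub_distrib, h1]
  simp only [Pi.single_eq_same, one_mul, Finset.sum_const, Finset.card_univ, nsmul_eq_mul,
    Pi.single_apply, ite_mul, zero_mul, Finset.sum_ite_eq', Finset.mem_univ,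
    if_true, ← Finset.sum_mul]
  simp only [mulVec, dotProduct]
  ring

end Conformal

/-! ### Three-dimensional linear algebra of curvature-like tensors. -/

section ThreeDim

open Matrix

variable {A : Type*} [CommRing A]

/-- `(i, j, m)` is a cyclic permutation of `(0, 1, 2)`. -/
def IsCyc (i j m : Fin 3) : Prop :=
  (i = 0 ∧ j = 1 ∧ m = 2) ∨ (i = 1 ∧ j = 2 ∧ m = 0) ∨ (i = 2 ∧ j = 0 ∧ m = 1)

/-- The pairing of a covector with the axial vector of an antisymmetric matrix. -/
def axial (ξ : Fin 3 → A) (S : Fin 3 → Fin 3 → A) : A :=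
  ξ 0 * S 1 2 + ξ 1 * S 2 0 + ξ 2 * S 0 1

/-- Reduces identities antisymmetric in an index pair to cyclic triples; diagonal entries vanish
since `2` is invertible. -/
lemma antisymm_ext [Algebra ℝ A] {F : Fin 3 → Fin 3 → A} (hF : ∀ i j, F i j = - F j i)
    (h0 : ∀ i j m, IsCyc i j m → F i j = 0) (i j : Fin 3) : F i j = 0 := by
  have hd : ∀ i, F i i = 0 := fun i => by
    linear_combination half A * hF i i - F i i * two_mul_half (A := A)
  have h1 := h0 0 1 2 (by simp [IsCyc])
  have h2 := h0 1 2 0 (by simp [IsCyc])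
  have h3 := h0 2 0 1 (by simp [IsCyc])
  have h1' := hF 1 0
  have h2' := hF 2 1
  have h3' := hF 0 2
  rw [h1, neg_zero] at h1'
  rw [h2, neg_zero] at h2'
  rw [h3, neg_zero] at h3'
  fin_cases i <;> fin_cases j <;> first | exact hd _ | assumption

/-- An antisymmetric matrix which kills `X` has axial vector proportional to `X`. -/
lemma dotProduct_mul_antisymm [Algebra ℝ A] {S : Fin 3 → Fin 3 → A} (hS : ∀ k l, S k l = - S l k)
    {X : Fin 3 → A} (hX : ∀ l, ∑ k, X k * S k l = 0) (ξ : Fin 3 → A) {k l b : Fin 3}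
    (hc : IsCyc k l b) : (ξ ⬝ᵥ X) * S k l = X b * axial ξ S := by
  have e0 := hX 0
  have e1 := hX 1
  have e2 := hX 2
  have hd : ∀ i, S i i = 0 := fun i => by
    linear_combination half A * hS i i - S i i * two_mul_half (A := A)
  simp only [Fin.sum_univ_three, hd, hS 1 0, hS 2 1, hS 0 2] at e0 e1 e2
  simp only [dotProduct, Fin.sum_univ_three, axial]
  rcases hc with ⟨rfl, rfl, rfl⟩ | ⟨rfl, rfl, rfl⟩ | ⟨rfl, rfl, rfl⟩
  · linear_combination ξ 0 * e1 - ξ 1 * e0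
  · linear_combination ξ 1 * e2 - ξ 2 * e1
  · linear_combination ξ 2 * e0 - ξ 0 * e2

lemma pair_symm [Algebra ℝ A] {ι : Type*} {T : ι → ι → ι → ι → A}
    (h1 : ∀ i j k l, T i j k l = - T j i k l)
    (h2 : ∀ i j k l, T i j k l = - T i j l k)
    (h3 : ∀ i j k l, T i j k l + T j k i l + T k i j l = 0) (i j k l : ι) :
    T i j k l = T k l i j := by
  -- The classical octahedron argument: four instances of the first Bianchi identity combined with
  -- the antisymmetries.
  have key : 2 * T i j k l = 2 * T k l i j := by
    linear_combination h3 i j k l - h3 i j l k + h3 j k l i - h3 k l i j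
      + h2 i j l k + h2 j l i k + h1 l i j k - h2 j k l i - h2 k l j i - h1 l j k i
      + h1 l i k j - h2 i l k j + h1 i k l j - h2 k i l j
  linear_combination half A * key - (T i j k l - T k l i j) * two_mul_half (A := A)

/-- `dotProduct_mul_antisymm` makes the axial vector of the last index pair proportional to `X`, and
pair symmetry does the same for the first pair. The factor `(ξ ⬝ᵥ X) ^ 2` is kept so that no
division is needed. -/
lemma curvature_rank_one [Algebra ℝ A] {T : Fin 3 → Fin 3 → Fin 3 → Fin 3 → A}
    (h1 : ∀ i j k l, T i j k l = - T j i k l)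
    (h2 : ∀ i j k l, T i j k l = - T i j l k)
    (h3 : ∀ i j k l, T i j k l + T j k i l + T k i j l = 0)
    {X : Fin 3 → A} (hX : ∀ i j l, ∑ k, X k * T i j k l = 0) (ξ : Fin 3 → A)
    {i j a k l b : Fin 3} (ha : IsCyc i j a) (hb : IsCyc k l b) :
    (ξ ⬝ᵥ X) ^ 2 * T i j k l = X a * X b * axial ξ (fun i j => axial ξ (T i j)) := by
  have e := fun i j {k l b} => dotProduct_mul_antisymm (h2 i j) (hX i j) ξ (k := k) (l := l)
    (b := b)
  have hp := pair_symm h1 h2 h3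
  have e0 := e 1 2 ha
  have e1 := e 2 0 ha
  have e2 := e 0 1 ha
  rw [hp _ _ i j] at e0 e1 e2
  have := e i j hb
  simp only [axial] at *
  linear_combination (ξ ⬝ᵥ X) * this + X b * (ξ 0 * e0 + ξ 1 * e1 + ξ 2 * e2)

/-- The cofactors of `h - ξ ⊗ ξ / c`, where `ξ = h X` and `c = h(X, X)`. -/
lemma cofactor_transverse {h : Matrix (Fin 3) (Fin 3) A} (hs : hᵀ = h) (X : Fin 3 → A)
    {ci : A} (hc : ((h *ᵥ X) ⬝ᵥ X) * ci = 1) {i j a k l b : Fin 3} (ha : IsCyc i j a)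
    (hb : IsCyc k l b) :
    ((h *ᵥ X) ⬝ᵥ X) *
      ((h i l - ci * ((h *ᵥ X) i * (h *ᵥ X) l)) * (h j k - ci * ((h *ᵥ X) j * (h *ᵥ X) k))
      - (h j l - ci * ((h *ᵥ X) j * (h *ᵥ X) l)) * (h i k - ci * ((h *ᵥ X) i * (h *ᵥ X) k)))
      = - (h.det * (X a * X b)) := by
  -- In the 2×2 minor the terms quadratic in `ci` cancel, so multiplying by `c` clears `ci` and
  -- leaves a polynomial identity. The minus sign comes from the column order `l, k`.
  have key : ((h *ᵥ X) ⬝ᵥ X) * (h i l * h j k - h j l * h i k)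
      - ((h *ᵥ X) i * (h *ᵥ X) l * h j k + (h *ᵥ X) j * (h *ᵥ X) k * h i l
        - (h *ᵥ X) j * (h *ᵥ X) l * h i k - (h *ᵥ X) i * (h *ᵥ X) k * h j l)
      = - (h.det * (X a * X b)) := by
    have s1 : h 1 0 = h 0 1 := congrFun (congrFun hs 0) 1
    have s2 : h 2 0 = h 0 2 := congrFun (congrFun hs 0) 2
    have s3 : h 2 1 = h 1 2 := congrFun (congrFun hs 1) 2
    simp only [det_fin_three, mulVec, dotProduct, Fin.sum_univ_three, s1, s2, s3]
    rcases ha with ⟨rfl, rfl, rfl⟩ | ⟨rfl, rfl, rfl⟩ | ⟨rfl, rfl, rfl⟩ <;>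
    rcases hb with ⟨rfl, rfl, rfl⟩ | ⟨rfl, rfl, rfl⟩ | ⟨rfl, rfl, rfl⟩ <;>
    simp only [s1, s2, s3] <;> ring
  rw [← key]
  generalize h *ᵥ X = ξ at *
  linear_combination (-(ξ i * ξ l * h j k + ξ j * ξ k * h i l - ξ j * ξ l * h i k
    - ξ i * ξ k * h j l)) * hc

end ThreeDim

/-! ### Curvature and Schouten tensor of a metric with a parallel field. -/

section ParallelField

open Matrix

set_option linter.unusedSectionVars false

variable {A : Type*} [CommRing A] [Algebra ℝ A]
variable {D : Fin 3 → Derivation ℝ A A} {h u : Matrix (Fin 3) (Fin 3) A}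
  {Γ : Fin 3 → Matrix (Fin 3) (Fin 3) A} {X : Fin 3 → A} {ci : A}

/-- The rows of `h / 2 - ξ ⊗ ξ / c`, where `ξ = h X` and `ci = 1 / c`. -/
def splitForm (h : Matrix (Fin 3) (Fin 3) A) (X : Fin 3 → A) (ci : A) (i : Fin 3) : Fin 3 → A :=
  half A • h i - (ci * (h *ᵥ X) i) • (h *ᵥ X)

lemma splitForm_symm (hs : hᵀ = h) (i j : Fin 3) :
    splitForm h X ci i j = splitForm h X ci j i := by
  have : h i j = h j i := congrFun (congrFun hs j) i
  simp only [splitForm, Pi.sub_apply, Pi.smul_apply, smul_eq_mul, this]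
  ring

lemma kulkarni_smul (K : A) (Q : Fin 3 → Fin 3 → A) (i j : Fin 3) :
    kulkarni u h (fun i => K • Q i) i j = K • kulkarni u h Q i j := by
  simp only [kulkarni, mulVec_smul, smul_vecMulVec, vecMulVec_smul, smul_add, smul_sub]

lemma mul_kulkarni_apply (hu : h * u = 1) (Q : Fin 3 → Fin 3 → A) (i j k l : Fin 3) :
    (h * kulkarni u h Q i j) l k
      = h l i * Q j k - h l j * Q i k + (Q i l * h j k - Q j l * h i k) := by
  simp only [kulkarni, Matrix.mul_add, Matrix.mul_sub, mul_vecMulVec, mulVec_mulVec, hu,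
    one_mulVec, Matrix.add_apply, Matrix.sub_apply, vecMulVec_apply, mulVec_single_one, col_apply]

/-- The curvature of a three-dimensional metric with a parallel vector field. -/
lemma exists_curv_eq_kulkarni (H : IsLevi D h Γ) (hu : h * u = 1)
    (hX : ∀ i, vecDeriv (D i) X = - (Γ i *ᵥ X)) (hc : ((h *ᵥ X) ⬝ᵥ X) * ci = 1) :
    ∃ K : A, ∀ i j, curv D Γ i j = kulkarni u h (fun i => K • splitForm h X ci i) i j := by
  set T : Fin 3 → Fin 3 → Fin 3 → Fin 3 → A := fun i j k l => (h * curv D Γ i j) l k with hT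
  have hs : ∀ i j, h i j = h j i := fun i j => congrFun (congrFun H.symm j) i
  have h1 : ∀ i j k l, T i j k l = - T j i k l := fun i j k l => by
    simp only [hT]; rw [curv_swap i j, Matrix.mul_neg, Matrix.neg_apply]
  have h2 : ∀ i j k l, T i j k l = - T i j l k := fun i j k l => by
    have := congrFun (congrFun (curv_metric H i j) l) k
    have hT' : (curv D Γ i j)ᵀ * h = (h * curv D Γ i j)ᵀ := by rw [transpose_mul, H.symm]
    rw [hT', Matrix.add_apply, transpose_apply, Matrix.zero_apply] at this
    exact eq_neg_of_add_eq_zero_left this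
  have h3 : ∀ i j k l, T i j k l + T j k i l + T k i j l = 0 := fun i j k l => by
    simp only [hT, Matrix.mul_apply, ← Finset.sum_add_distrib, ← mul_add]
    exact Finset.sum_eq_zero fun m _ => by rw [curv_bianchi₁ H, mul_zero]
  have h4 : ∀ i j l, ∑ k, X k * T i j k l = 0 := fun i j l => by
    have : ((h * curv D Γ i j) *ᵥ X) l = 0 := by
      rw [← mulVec_mulVec, curv_mulVec_parallel H hX]; simp
    rw [← this]
    exact Finset.sum_congr rfl fun k _ => mul_comm _ _
  have hdet : h.det * u.det = 1 := by rw [← det_mul, hu, det_one]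
  set κ := axial (h *ᵥ X) (fun i j => axial (h *ᵥ X) (T i j)) with hκ
  -- With `τ` the minor in `cofactor_transverse`, `c² T = κ XᵃXᵇ` and `c τ = -(det h) XᵃXᵇ`.
  -- Eliminating `XᵃXᵇ` gives `T = -(κ ci det u) τ`, and `τ` is the lowered Kulkarni–Nomizu product
  -- of `splitForm` with `h`.
  refine ⟨-(κ * ci * u.det), fun i j => ?_⟩
  suffices hh : h * curv D Γ i j
      = h * kulkarni u h (fun i => (-(κ * ci * u.det)) • splitForm h X ci i) i j by
    have := congrArg (u * ·) hh
    simpa only [← Matrix.mul_assoc, mul_eq_one_comm.mp hu, Matrix.one_mul] using this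
  ext l k
  rw [mul_kulkarni_apply hu, ← sub_eq_zero]
  have hant := two_mul_half (A := A)
  set F : Fin 3 → Fin 3 → Fin 3 → Fin 3 → A := fun i j k l => T i j k l + κ * ci * u.det *
    ((h i l - ci * ((h *ᵥ X) i * (h *ᵥ X) l)) * (h j k - ci * ((h *ᵥ X) j * (h *ᵥ X) k))
      - (h j l - ci * ((h *ᵥ X) j * (h *ᵥ X) l)) * (h i k - ci * ((h *ᵥ X) i * (h *ᵥ X) k)))
    with hF
  have hF0 : F i j k l = 0 := by
    refine antisymm_ext (F := fun i j => F i j k l) (fun i j => ?_) (fun i j a ha => ?_) i j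
    · simp only [hF]; rw [h1]; ring
    refine antisymm_ext (F := fun k l => F i j k l) (fun k l => ?_) (fun k l b hb => ?_) k l
    · simp only [hF]; rw [h2]; ring
    have e1 := curvature_rank_one h1 h2 h3 h4 (h *ᵥ X) ha hb
    have e2 := cofactor_transverse H.symm X hc ha hb
    rw [← hκ] at e1
    simp only [hF]
    set τ := (h i l - ci * ((h *ᵥ X) i * (h *ᵥ X) l)) * (h j k - ci * ((h *ᵥ X) j * (h *ᵥ X) k))
      - (h j l - ci * ((h *ᵥ X) j * (h *ᵥ X) l)) * (h i k - ci * ((h *ᵥ X) i * (h *ᵥ X) k))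
    set c := (h *ᵥ X) ⬝ᵥ X
    linear_combination ci ^ 2 * e1 + κ * ci ^ 2 * u.det * e2 - κ * ci ^ 2 * X a * X b * hdet
      - T i j k l * (c * ci + 1) * hc - κ * ci * u.det * τ * hc
  rw [← hF0]
  simp only [hF, hT, splitForm, Pi.sub_apply, Pi.smul_apply, smul_eq_mul, hs l i, hs l j]
  linear_combination (κ * ci * u.det * (h i l * h j k - h j l * h i k)) * hant

/-- Lowering an index preserves parallelism, because `h` itself is covariantly constant. -/
lemma vecDeriv_flat (H : IsLevi D h Γ) (hX : ∀ i, vecDeriv (D i) X = - (Γ i *ᵥ X)) (i : Fin 3) :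
    vecDeriv (D i) (h *ᵥ X) = (h *ᵥ X) ᵥ* Γ i := by
  rw [vecDeriv_mulVec, hX, H.compat, add_mulVec, mulVec_neg, ← mulVec_mulVec, ← mulVec_mulVec,
    mulVec_transpose]
  abel

lemma deriv_flat (H : IsLevi D h Γ) (hX : ∀ i, vecDeriv (D i) X = - (Γ i *ᵥ X)) (i j : Fin 3) :
    D i ((h *ᵥ X) j) = (h *ᵥ X) ⬝ᵥ (Γ i *ᵥ Pi.single j 1) := by
  have := congrFun (vecDeriv_flat H hX i) j
  rw [mulVec_single_one]
  exact this

lemma deriv_normSq_parallel (H : IsLevi D h Γ) (hX : ∀ i, vecDeriv (D i) X = - (Γ i *ᵥ X))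
    (i : Fin 3) : D i ((h *ᵥ X) ⬝ᵥ X) = 0 := by
  rw [deriv_dotProduct, vecDeriv_flat H hX, hX, ← dotProduct_mulVec, dotProduct_neg,
    add_neg_cancel]

lemma deriv_inv_normSq (H : IsLevi D h Γ) (hX : ∀ i, vecDeriv (D i) X = - (Γ i *ᵥ X))
    (hc : ((h *ᵥ X) ⬝ᵥ X) * ci = 1) (i : Fin 3) : D i ci = 0 := by
  have h1 := congrArg (D i) hc
  rw [Derivation.leibniz, deriv_normSq_parallel H hX, Derivation.map_one_eq_zero, smul_eq_mul,
    smul_zero, add_zero] at h1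
  linear_combination ci * h1 - D i ci * hc

/-- `splitForm` is covariantly constant, so only `K` gets differentiated. This is the Cotton tensor
of the metric with the parallel field. -/
lemma covExt_splitForm (H : IsLevi D h Γ) (hX : ∀ i, vecDeriv (D i) X = - (Γ i *ᵥ X))
    (hc : ((h *ᵥ X) ⬝ᵥ X) * ci = 1) (K : A) (i j : Fin 3) :
    covExt D Γ (fun i => K • splitForm h X ci i) i j
      = D i K • splitForm h X ci j - D j K • splitForm h X ci i := by
  simp only [covExt, splitForm, vecDeriv_smul, vecDeriv_sub, Derivation.leibniz, deriv_half,
    deriv_inv_normSq H hX hc, deriv_flat H hX, vecDeriv_flat H hX, vecDeriv_row H,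
    smul_vecMul, sub_vecMul, mulVec_single_comm H j i]
  ext k
  simp only [Pi.add_apply, Pi.sub_apply, Pi.smul_apply, smul_eq_mul]
  ring

lemma sharp_splitForm (H : IsLevi D h Γ) (hu : h * u = 1) (i : Fin 3) :
    u *ᵥ splitForm h X ci i = half A • Pi.single i 1 - (ci * (h *ᵥ X) i) • X := by
  rw [splitForm, mulVec_sub, mulVec_smul, mulVec_smul, sharp_row H hu, mulVec_mulVec,
    mul_eq_one_comm.mp hu, one_mulVec]

/-- The second Bianchi identity for a curvature of split type. -/
lemma bianchi_splitForm (H : IsLevi D h Γ) (hu : h * u = 1)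
    (hX : ∀ i, vecDeriv (D i) X = - (Γ i *ᵥ X)) (hc : ((h *ᵥ X) ⬝ᵥ X) * ci = 1) {K : A}
    (hK : ∀ i j, curv D Γ i j = kulkarni u h (fun i => K • splitForm h X ci i) i j)
    (a i j : Fin 3) :
    D a K • kulkarni u h (splitForm h X ci) i j + D i K • kulkarni u h (splitForm h X ci) j a
      + D j K • kulkarni u h (splitForm h X ci) a i = 0 := by
  -- All ingredients of the curvature except `K` are covariantly constant, so the cyclic sum reduces
  -- to derivatives of `K`.
  have := curv_bianchi₂ H a i j
  rw [← this]
  simp only [hK, kulkarni_smul]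
  simp only [kulkarni, sharp_splitForm H hu, matDeriv_smul, matDeriv_add, matDeriv_sub,
    matDeriv_vecMulVec]
  simp only [splitForm, vecDeriv_sub, vecDeriv_smul, vecDeriv_single, Derivation.leibniz,
    deriv_half, deriv_inv_normSq H hX hc, deriv_flat H hX, vecDeriv_flat H hX, vecDeriv_row H, hX,
    mulVec_single_comm H j i, mulVec_single_comm H i a, mulVec_single_comm H j a,
    Matrix.mul_smul, Matrix.smul_mul, Matrix.mul_add, Matrix.mul_sub, Matrix.add_mul,
    Matrix.sub_mul, mul_vecMulVec, vecMulVec_mul, mulVec_sub, mulVec_smul, sub_vecMul,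
    smul_vecMul]
  ext k l
  simp only [Matrix.add_apply, Matrix.sub_apply, Matrix.smul_apply, vecMulVec_apply,
    Pi.add_apply, Pi.sub_apply, Pi.smul_apply, Pi.zero_apply, Pi.neg_apply, smul_eq_mul]
  ring

/-- The product is built from minors of `h - ξ ⊗ ξ / c`, whose kernel contains `X`. -/
lemma sum_mul_kulkarni_splitForm (H : IsLevi D h Γ) (hu : h * u = 1)
    (hc : ((h *ᵥ X) ⬝ᵥ X) * ci = 1) (j k l : Fin 3) :
    ∑ a, X a * kulkarni u h (splitForm h X ci) j a k l = 0 := by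
  have s1 : ∑ a, X a * h a l = (h *ᵥ X) l := by
    change _ = ∑ a, h l a * X a
    refine Finset.sum_congr rfl fun a _ => ?_
    rw [mul_comm, ← congrFun (congrFun H.symm a) l]; rfl
  have s2 : ∑ a, X a * (h *ᵥ X) a = (h *ᵥ X) ⬝ᵥ X :=
    Finset.sum_congr rfl fun a _ => mul_comm _ _
  have s3 : ∑ a, X a * Pi.single (M := fun _ => A) a 1 k = X k := by
    simp [Pi.single_apply]
  have : ∀ a, X a * kulkarni u h (splitForm h X ci) j a k l
    = X a * h a l * (half A * Pi.single (M := fun _ => A) j 1 k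
        + (half A * Pi.single (M := fun _ => A) j 1 k - ci * (h *ᵥ X) j * X k))
      - X a * (h *ᵥ X) a * (ci * (h *ᵥ X) l * Pi.single (M := fun _ => A) j 1 k
        - ci * X k * h j l)
      - X a * Pi.single (M := fun _ => A) a 1 k * (half A * h j l - ci * (h *ᵥ X) j * (h *ᵥ X) l
        + half A * h j l) := by
    intro a
    simp only [kulkarni, sharp_splitForm H hu]
    simp only [splitForm, Matrix.add_apply, Matrix.sub_apply, vecMulVec_apply,
      Pi.sub_apply, Pi.smul_apply, smul_eq_mul]
    ring
  simp only [this, Finset.sum_sub_distrib, ← Finset.sum_mul, s1, s2, s3]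
  linear_combination (X k * h j l - (h *ᵥ X) l * Pi.single (M := fun _ => A) j 1 k) * hc
    + ((h *ᵥ X) l * Pi.single (M := fun _ => A) j 1 k - X k * h j l) * two_mul_half (A := A)

lemma sum_inv_mul (H : IsLevi D h Γ) (hu : h * u = 1) : ∑ a, ∑ b, u a b * h a b = 3 := by
  have : (u * h).trace = 3 := by rw [mul_eq_one_comm.mp hu]; simp
  rw [← this, trace]
  refine Finset.sum_congr rfl fun a _ => ?_
  rw [diag_apply, Matrix.mul_apply]
  exact Finset.sum_congr rfl fun b _ => by rw [← congrFun (congrFun H.symm a) b]; rfl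

lemma trace_splitForm (H : IsLevi D h Γ) (hu : h * u = 1)
    (hc : ((h *ᵥ X) ⬝ᵥ X) * ci = 1) :
    2 * ∑ a, ∑ b, u a b * splitForm h X ci a b = 1 := by
  have h1 : ∑ a, ∑ b, u a b * ((h *ᵥ X) a * (h *ᵥ X) b) = (h *ᵥ X) ⬝ᵥ X := by
    have : (h *ᵥ X) ⬝ᵥ (u *ᵥ (h *ᵥ X)) = (h *ᵥ X) ⬝ᵥ X := by
      rw [mulVec_mulVec, mul_eq_one_comm.mp hu, one_mulVec]
    rw [← this, dotProduct]
    refine Finset.sum_congr rfl fun a _ => ?_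
    change _ = (h *ᵥ X) a * ∑ b, u a b * (h *ᵥ X) b
    rw [Finset.mul_sum]
    exact Finset.sum_congr rfl fun b _ => by ring
  have h2 : ∑ a, ∑ b, u a b * splitForm h X ci a b
      = half A * ∑ a, ∑ b, u a b * h a b
        - ci * ∑ a, ∑ b, u a b * ((h *ᵥ X) a * (h *ᵥ X) b) := by
    simp only [Finset.mul_sum, ← Finset.sum_sub_distrib]
    refine Finset.sum_congr rfl fun a _ => Finset.sum_congr rfl fun b _ => ?_
    simp only [splitForm, Pi.sub_apply, Pi.smul_apply, smul_eq_mul]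
    ring
  rw [h2, h1, sum_inv_mul H hu]
  linear_combination 3 * two_mul_half (A := A) - 2 * hc

/-- The Gauss curvature `K` transverse to a parallel field `X` is invariant under `X`. -/
lemma deriv_along_parallel (H : IsLevi D h Γ) (hu : h * u = 1)
    (hX : ∀ i, vecDeriv (D i) X = - (Γ i *ᵥ X)) (hc : ((h *ᵥ X) ⬝ᵥ X) * ci = 1) {K : A}
    (hK : ∀ i j, curv D Γ i j = kulkarni u h (fun i => K • splitForm h X ci i) i j) :
    ∑ a, X a * D a K = 0 := by
  -- Contracting the Bianchi identity with `X` in the slot `a` kills the other two terms.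
  have key : ∀ i j k l, (∑ a, X a * D a K) * kulkarni u h (splitForm h X ci) i j k l = 0 := by
    intro i j k l
    have h1 : ∀ a, X a * D a K * kulkarni u h (splitForm h X ci) i j k l
        = D j K * (X a * kulkarni u h (splitForm h X ci) i a k l)
          - D i K * (X a * kulkarni u h (splitForm h X ci) j a k l) := by
      intro a
      have h2 := congrFun (congrFun (bianchi_splitForm H hu hX hc hK a i j) k) l
      have h3 : kulkarni u h (splitForm h X ci) a i k l
          = - kulkarni u h (splitForm h X ci) i a k l := by
        simp only [kulkarni, Matrix.add_apply, Matrix.sub_apply]; ring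
      simp only [Matrix.add_apply, Matrix.smul_apply, smul_eq_mul, h3, Matrix.zero_apply] at h2
      linear_combination X a * h2
    rw [Finset.sum_mul]
    simp only [h1, Finset.sum_sub_distrib, ← Finset.mul_sum, sum_mul_kulkarni_splitForm H hu hc,
      mul_zero, sub_zero]
  set Y := ∑ a, X a * D a K
  have h1 : ∀ j k, Y * ∑ i, kulkarni u h (splitForm h X ci) i j i k = 0 := fun j k => by
    rw [Finset.mul_sum]; exact Finset.sum_eq_zero fun i _ => key i j i k
  -- The full trace of the product is `4 t` with `2 t = 1`, thus the unit `2`, which can be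
  -- cancelled from the vanishing product.
  have h2 : Y * ∑ j, ∑ k, u j k * ∑ i, kulkarni u h (splitForm h X ci) i j i k = 0 := by
    simp only [Finset.mul_sum Finset.univ _ Y]
    refine Finset.sum_eq_zero fun j _ => Finset.sum_eq_zero fun k _ => ?_
    rw [mul_left_comm, h1, mul_zero]
  set t := ∑ a, ∑ b, u a b * splitForm h X ci a b with ht
  have h3 : ∑ j, ∑ k, u j k * ∑ i, kulkarni u h (splitForm h X ci) i j i k = 4 * t := by
    have : ∀ j k, u j k * ∑ i, kulkarni u h (splitForm h X ci) i j i k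
        = u j k * splitForm h X ci j k + t * (u j k * h j k) := fun j k => by
      rw [sum_kulkarni H hu, ← ht]; simp only [Fintype.card_fin]; push_cast; ring
    simp only [this, Finset.sum_add_distrib, ← Finset.mul_sum, sum_inv_mul H hu, ← ht]
    ring
  rw [h3] at h2
  linear_combination half A * h2 - Y * two_mul_half (A := A)
    - 2 * Y * half A * trace_splitForm H hu hc

end ParallelField

/-! ### Cotton tensor of a metric conformal to one with a parallel field. -/

section ConformalCotton

open Matrix

variable {A : Type*} [CommRing A] [Algebra ℝ A]

/-- The Ricci tensor of the metric `γ` with inverse `v`. -/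
def ricForm (D : Fin 3 → Derivation ℝ A A) (v γ : Matrix (Fin 3) (Fin 3) A) (j k : Fin 3) : A :=
  ∑ i, curv D (levi D v γ) i j i k

/-- The three-dimensional Schouten tensor of the metric `γ` with inverse `v`. -/
def schForm (D : Fin 3 → Derivation ℝ A A) (v γ : Matrix (Fin 3) (Fin 3) A) (j k : Fin 3) : A :=
  ricForm D v γ j k - half A * half A * (∑ a, ∑ b, v a b * ricForm D v γ a b) * γ j k

variable {D : Fin 3 → Derivation ℝ A A} {h u : Matrix (Fin 3) (Fin 3) A} {X : Fin 3 → A} {ci : A}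

/-- The Schouten tensor is determined by a Kulkarni–Nomizu form of the curvature. -/
lemma schForm_eq_of_curv {Γ : Fin 3 → Matrix (Fin 3) (Fin 3) A} (H : IsLevi D h Γ)
    (hu : h * u = 1) {w wi : A} (hw : w * wi = 1) {Q : Fin 3 → Fin 3 → A}
    (hQ : ∀ i j, curv D (levi D (wi • u) (w • h)) i j = kulkarni u h Q i j) (j k : Fin 3) :
    schForm D (wi • u) (w • h) j k = Q j k := by
  set t := ∑ a, ∑ b, u a b * Q a b with ht
  have hr : ∀ j k, ricForm D (wi • u) (w • h) j k = Q j k + t * h j k := fun j k => by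
    simp only [ricForm, hQ]
    rw [sum_kulkarni H hu, ← ht]; simp only [Fintype.card_fin]; push_cast; ring
  -- The Kulkarni–Nomizu product is unchanged under `(u, h) ↦ (wi • u, w • h)` up to rescaling that
  -- appears only here; the factor `wi` is absorbed by the metric `w • h` in the Schouten tensor.
  have hscal : ∑ a, ∑ b, (wi • u) a b * ricForm D (wi • u) (w • h) a b = 4 * wi * t := by
    have : ∀ a b, (wi • u) a b * ricForm D (wi • u) (w • h) a b
        = wi * (u a b * Q a b) + wi * t * (u a b * h a b) := fun a b => by
      rw [hr]; simp only [Matrix.smul_apply, smul_eq_mul]; ring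
    simp only [this, Finset.sum_add_distrib, ← Finset.mul_sum, sum_inv_mul H hu, ← ht]
    ring
  rw [schForm, hscal, hr]
  simp only [Matrix.smul_apply, smul_eq_mul]
  linear_combination (-(2 * half A * t * h j k + t * h j k)) * two_mul_half (A := A)
    - 4 * half A ^ 2 * t * h j k * hw

/-- The Cotton tensor of a metric conformal to one with a parallel vector field. -/
theorem exists_covExt_schForm (hs : hᵀ = h) (hD : ∀ i j a, D i (D j a) = D j (D i a))
    (hu : h * u = 1) (hX : ∀ i, vecDeriv (D i) X = - (levi D u h i *ᵥ X))
    (hc : ((h *ᵥ X) ⬝ᵥ X) * ci = 1) {w wi φ : A} (hw : w * wi = 1)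
    (hφ : ∀ i, D i w = 2 * w * D i φ) :
    ∃ K : A, ∑ a, X a * D a K = 0 ∧ ∀ i j,
      covExt D (levi D (wi • u) (w • h)) (schForm D (wi • u) (w • h)) i j
        = D i K • splitForm h X ci j - D j K • splitForm h X ci i := by
  have H := isLevi_levi (D := D) hs hD hu
  obtain ⟨K, hK⟩ := exists_curv_eq_kulkarni H hu hX hc
  refine ⟨K, deriv_along_parallel H hu hX hc hK, fun i j => ?_⟩
  have hΓ : levi D (wi • u) (w • h) = fun i => levi D u h i + confDiff D u h φ i :=
    funext fun i => levi_conformal hs (mul_eq_one_comm.mp hu) hw hφ i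
  have hS : schForm D (wi • u) (w • h)
      = fun i => K • splitForm h X ci i - confSchouten D u h (levi D u h) φ i := by
    funext a b
    refine schForm_eq_of_curv H hu hw (Q := fun i => K • splitForm h X ci i
      - confSchouten D u h (levi D u h) φ i) (fun i j => ?_) a b
    rw [hΓ, curv_conformal H hu, hK, ← kulkarni_sub]
  rw [hS, hΓ, covExt_conformal H hu φ (fun i j => ?_) hK, covExt_splitForm H hX hc]
  simp only [Pi.smul_apply, splitForm_symm hs i j]

end ConformalCotton

/-! ### Smooth functions on an open set as a ring with commuting derivations. -/

section SmoothFunctions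

open TopologicalSpace

variable {n : ℕ}

/-- The algebra of smooth functions on an open subset of `ℝⁿ`. -/
def smoothFun (U : Opens (Model n)) : Subalgebra ℝ (U → ℝ) where
  carrier := {a | ∃ F : Model n → ℝ, ContDiffOn ℝ ∞ F U ∧ ∀ x : U, F x = a x}
  mul_mem' := by
    rintro a b ⟨F, hF, hFa⟩ ⟨G, hG, hGb⟩
    exact ⟨fun x => F x * G x, hF.mul hG, fun x => by simp [hFa, hGb]⟩
  add_mem' := by
    rintro a b ⟨F, hF, hFa⟩ ⟨G, hG, hGb⟩
    exact ⟨fun x => F x + G x, hF.add hG, fun x => by simp [hFa, hGb]⟩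
  algebraMap_mem' r := ⟨fun _ => r, contDiffOn_const, fun x => rfl⟩

variable {U : Opens (Model n)}

/-- The smooth function on `U` with the given extension. -/
def smoothFun.of {F : Model n → ℝ} (hF : ContDiffOn ℝ ∞ F U) : smoothFun U :=
  ⟨fun x => F x, F, hF, fun _ => rfl⟩

/-- An extension of a smooth function on `U` by arbitrary values outside of `U`. -/
def smoothRep (a : smoothFun U) : Model n → ℝ := a.2.choose

lemma contDiffOn_smoothRep (a : smoothFun U) : ContDiffOn ℝ ∞ (smoothRep a) U := a.2.choose_spec.1

lemma smoothRep_apply (a : smoothFun U) (x : U) : (smoothRep a) x = a.1 x := a.2.choose_spec.2 x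

lemma differentiableAt_smoothRep (a : smoothFun U) (x : U) : DifferentiableAt ℝ (smoothRep a) x :=
  ((contDiffOn_smoothRep a).contDiffAt (U.2.mem_nhds x.2)).differentiableAt (by simp)

/-- A partial derivative depends only on the germ, so the arbitrary values chosen by `smoothRep`
outside `U` are harmless. -/
lemma pd_congr {F G : Model n → ℝ} (h : ∀ x : U, F x = G x) (i : Fin n) (x : U) :
    pd i F x = pd i G x := by
  have : F =ᶠ[nhds (x : Model n)] G := by
    filter_upwards [U.2.mem_nhds x.2] with y hy using h ⟨y, hy⟩
  rw [pd, pd, this.fderiv_eq]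

lemma contDiffOn_pd {F : Model n → ℝ} (hF : ContDiffOn ℝ ∞ F U) (i : Fin n) :
    ContDiffOn ℝ ∞ (pd i F) U :=
  (hF.fderiv_of_isOpen U.2 (by simp)).clm_apply contDiffOn_const

/-- The partial derivative as a derivation of the algebra of smooth functions. -/
def smoothPd (U : Opens (Model n)) (i : Fin n) : Derivation ℝ (smoothFun U) (smoothFun U) :=
  Derivation.mk'
    { toFun := fun a => smoothFun.of (contDiffOn_pd (contDiffOn_smoothRep a) i)
      map_add' := fun a b => by
        ext x
        change pd i (smoothRep (a + b)) x = pd i (smoothRep a) x + pd i (smoothRep b) x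
        rw [pd_congr (G := smoothRep a + smoothRep b) (fun y => by simp [smoothRep_apply]) i x, pd,
          fderiv_add ((differentiableAt_smoothRep a x)) ((differentiableAt_smoothRep b x))]
        rfl
      map_smul' := fun r a => by
        ext x
        change pd i (smoothRep (r • a)) x = r * pd i (smoothRep a) x
        rw [pd_congr (G := r • (smoothRep a)) (fun y => by simp [smoothRep_apply]) i x, pd,
          fderiv_const_smul ((differentiableAt_smoothRep a x))]
        rfl }
    fun a b => by
      ext x
      change pd i (smoothRep (a * b)) x
        = a.1 x * pd i (smoothRep b) x + b.1 x * pd i (smoothRep a) x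
      rw [pd_congr (G := smoothRep a * smoothRep b) (fun y => by simp [smoothRep_apply]) i x, pd,
        fderiv_mul ((differentiableAt_smoothRep a x)) ((differentiableAt_smoothRep b x)),
        smoothRep_apply, smoothRep_apply]
      rfl

lemma pd_eq_smoothPd {F : Model n → ℝ} {a : smoothFun U} (h : ∀ x : U, F x = a.1 x) (i : Fin n)
    (x : U) : pd i F x = (smoothPd U i a).1 x :=
  pd_congr (fun y => by rw [h, smoothRep_apply a]) i x

lemma smoothPd_comm (i j : Fin n) (a : smoothFun U) :
    smoothPd U i (smoothPd U j a) = smoothPd U j (smoothPd U i a) := by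
  ext x
  have h1 : ∀ i j, (smoothPd U i (smoothPd U j a)).1 x = pd i (pd j (smoothRep a)) x := fun i j =>
    (pd_eq_smoothPd (fun y => rfl) i x).symm
  rw [h1, h1]
  have hF := (contDiffOn_smoothRep a).contDiffAt (U.2.mem_nhds x.2)
  have hd : DifferentiableAt ℝ (fderiv ℝ (smoothRep a)) x :=
    (hF.fderiv_right (m := 1) (by norm_cast)).differentiableAt (by simp)
  have h2 : ∀ i j, pd i (pd j (smoothRep a)) x = fderiv ℝ (fderiv ℝ (smoothRep a)) x
      (EuclideanSpace.single i 1) (EuclideanSpace.single j 1) := fun i j => by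
    change fderiv ℝ (fun y => fderiv ℝ (smoothRep a) y (EuclideanSpace.single j 1)) x _ = _
    rw [fderiv_clm_apply hd (differentiableAt_const _)]
    simp
  rw [h2, h2]
  exact (hF.isSymmSndFDerivAt (by simp; norm_cast)).eq _ _

/-- Turns pointwise nonvanishing of `det h` and `h(X, X)` into invertibility in the ring, as the
algebraic results require. -/
lemma smoothFun.exists_inv (a : smoothFun U) (ha : ∀ x, a.1 x ≠ 0) : ∃ b, a * b = 1 := by
  refine ⟨smoothFun.of (F := fun x => (smoothRep a x)⁻¹)
    ((contDiffOn_smoothRep a).inv fun x hx => ?_), ?_⟩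
  · rw [(smoothRep_apply a) ⟨x, hx⟩]; exact ha _
  · ext x
    change a.1 x * (smoothRep a x)⁻¹ = 1
    rw [(smoothRep_apply a), mul_inv_cancel₀ (ha x)]

/-- Evaluation of smooth functions at a point. -/
def smoothEval (x : U) : smoothFun U →ₐ[ℝ] ℝ :=
  (Pi.evalAlgHom ℝ (fun _ : U => ℝ) x).comp (smoothFun U).val

lemma smoothEval_apply (x : U) (a : smoothFun U) : smoothEval x a = a.1 x := rfl

end SmoothFunctions

/-! ### Passage from the algebraic calculus to coordinate expressions. -/

section Transfer

open TopologicalSpace Matrix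

variable {U : Opens (Model 3)} {G : Model 3 → Matrix (Fin 3) (Fin 3) ℝ}
  {γ v : Matrix (Fin 3) (Fin 3) (smoothFun U)}

lemma pd_eq_smoothEval {F : Model 3 → ℝ} {a : smoothFun U} (h : ∀ x : U, F x = smoothEval x a)
    (i : Fin 3) (x : U) : pd i F x = smoothEval x (smoothPd U i a) := pd_eq_smoothPd h i x

lemma smoothEval_half (x : U) : smoothEval x (half (smoothFun U)) = 1 / 2 := rfl

lemma inv_eq_smoothEval (hv : γ * v = 1) (hG : ∀ (x : U) i j, G x i j = smoothEval x (γ i j))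
    (x : U) (i j : Fin 3) : (G x)⁻¹ i j = smoothEval x (v i j) := by
  have h1 : G x = γ.map (smoothEval x) := by ext i j; exact hG x i j
  have h2 : γ.map (smoothEval x) * v.map (smoothEval x) = 1 := by
    rw [← Matrix.map_mul, hv]
    exact Matrix.map_one _ (map_zero _) (map_one _)
  rw [h1, inv_eq_right_inv h2, Matrix.map_apply]

lemma christoffel_eq_smoothEval (hv : γ * v = 1)
    (hG : ∀ (x : U) i j, G x i j = smoothEval x (γ i j)) (k i j : Fin 3) (x : U) :
    christoffel G k i j x = smoothEval x (levi (smoothPd U) v γ i k j) := by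
  simp only [christoffel, levi, of_apply, map_mul, map_sum, map_add, map_sub, smoothEval_half,
    inv_eq_smoothEval hv hG]
  congr 1
  refine Finset.sum_congr rfl fun l _ => ?_
  rw [pd_eq_smoothEval (fun y => hG y j l), pd_eq_smoothEval (fun y => hG y i l),
    pd_eq_smoothEval (fun y => hG y i j)]

lemma riemann_eq_smoothEval (hv : γ * v = 1)
    (hG : ∀ (x : U) i j, G x i j = smoothEval x (γ i j)) (l i j k : Fin 3) (x : U) :
    riemann G l i j k x = smoothEval x (curv (smoothPd U) (levi (smoothPd U) v γ) i j l k) := by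
  simp only [riemann, curv, matDeriv, Matrix.add_apply, Matrix.sub_apply, of_apply,
    Matrix.mul_apply, map_mul, map_sum, map_add, map_sub, Finset.sum_sub_distrib,
    christoffel_eq_smoothEval hv hG]
  rw [pd_eq_smoothEval (christoffel_eq_smoothEval hv hG l j k),
    pd_eq_smoothEval (christoffel_eq_smoothEval hv hG l i k)]

lemma schouten_eq_smoothEval (hv : γ * v = 1)
    (hG : ∀ (x : U) i j, G x i j = smoothEval x (γ i j)) (j k : Fin 3) (x : U) :
    schouten G j k x = smoothEval x (schForm (smoothPd U) v γ j k) := by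
  have hr : ∀ j k, ricci G j k x = smoothEval x (ricForm (smoothPd U) v γ j k) := fun j k => by
    simp only [ricci, ricForm, map_sum, riemann_eq_smoothEval hv hG]
  simp only [schouten, scalarCurv, schForm, map_sub, map_mul, map_sum, smoothEval_half, hr,
    inv_eq_smoothEval hv hG, hG]
  push_cast
  ring

/-- The Christoffel terms acting on the first index of the Schouten tensor cancel under
antisymmetrisation, by torsion-freeness; what remains is `covExt`. -/
lemma cotton_eq_smoothEval (hs : γᵀ = γ) (hv : γ * v = 1)
    (hG : ∀ (x : U) i j, G x i j = smoothEval x (γ i j)) (i j k : Fin 3) (x : U) :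
    cotton G i j k x = smoothEval x
      (covExt (smoothPd U) (levi (smoothPd U) v γ) (schForm (smoothPd U) v γ) i j k) := by
  have ht := (isLevi_levi (D := smoothPd U) hs smoothPd_comm hv).torsion
  have hS := schouten_eq_smoothEval hv hG
  simp only [cotton, nablaSchouten, covExt, vecDeriv, Pi.add_apply, Pi.sub_apply, vecMul,
    dotProduct, map_add, map_sub, map_sum, map_mul, christoffel_eq_smoothEval hv hG]
  rw [pd_eq_smoothEval (hS j k), pd_eq_smoothEval (hS i k)]
  simp only [hS, ht i j]
  simp only [Fin.sum_univ_three]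
  ring

/-- A parallel vector field in coordinates, as a vector over the algebra of smooth functions. -/
lemma parallel_lift {V : Model 3 → Fin 3 → ℝ}
    (hG : ∀ i j, ContDiffOn ℝ ∞ (fun x => G x i j) U) (hV : ∀ i, ContDiffOn ℝ ∞ (fun x => V x i) U)
    (hs : ∀ x : U, (G x)ᵀ = G x) (hdet : ∀ x : U, (G x).det ≠ 0)
    (hpar : ∀ (x : U) (i k : Fin 3),
      pd i (fun y => V y k) x + ∑ j, christoffel G k i j x * V x j = 0) :
    letI h : Matrix (Fin 3) (Fin 3) (smoothFun U) := of fun i j => smoothFun.of (hG i j)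
    letI X : Fin 3 → smoothFun U := fun i => smoothFun.of (hV i)
    hᵀ = h ∧ h * h⁻¹ = 1 ∧
      ∀ i, vecDeriv (smoothPd U i) X = - (levi (smoothPd U) h⁻¹ h i *ᵥ X) := by
  set h : Matrix (Fin 3) (Fin 3) (smoothFun U) := of fun i j => smoothFun.of (hG i j) with hh
  set X : Fin 3 → smoothFun U := fun i => smoothFun.of (hV i) with hX
  have eh : ∀ (x : U) i j, G x i j = smoothEval x (h i j) := fun x i j => rfl
  have eX : ∀ (x : U) i, V x i = smoothEval x (X i) := fun x i => rfl
  obtain ⟨di, hdi⟩ := smoothFun.exists_inv h.det fun x => by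
    have : smoothEval x h.det = (G x).det := by
      rw [AlgHom.map_det]; rfl
    rw [← smoothEval_apply, this]; exact hdet x
  have hu : h * h⁻¹ = 1 := mul_nonsing_inv h (IsUnit.of_mul_eq_one di hdi)
  refine ⟨?_, hu, fun i => ?_⟩
  · ext i j x
    exact congrFun (congrFun (hs x) i) j
  · ext k x
    have h1 := hpar x i k
    rw [pd_eq_smoothEval (fun y => eX y k)] at h1
    simp only [christoffel_eq_smoothEval hu eh, eX] at h1
    rw [← smoothEval_apply, ← smoothEval_apply]
    simp only [vecDeriv, Pi.neg_apply, mulVec, dotProduct, map_neg, map_sum, map_mul]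
    exact eq_neg_of_add_eq_zero_left h1

/-- A parallel vector field has constant length. -/
theorem pd_normSq_eq_zero {V : Model 3 → Fin 3 → ℝ}
    (hG : ∀ i j, ContDiffOn ℝ ∞ (fun x => G x i j) U) (hV : ∀ i, ContDiffOn ℝ ∞ (fun x => V x i) U)
    (hs : ∀ x : U, (G x)ᵀ = G x) (hdet : ∀ x : U, (G x).det ≠ 0)
    (hpar : ∀ (x : U) (i k : Fin 3),
      pd i (fun y => V y k) x + ∑ j, christoffel G k i j x * V x j = 0) (i : Fin 3) (x : U) :
    pd i (fun y => (G y *ᵥ V y) ⬝ᵥ V y) x = 0 := by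
  set h : Matrix (Fin 3) (Fin 3) (smoothFun U) := of fun i j => smoothFun.of (hG i j) with hh
  set X : Fin 3 → smoothFun U := fun i => smoothFun.of (hV i) with hX
  obtain ⟨hsym, hu, hpar'⟩ := parallel_lift hG hV hs hdet hpar
  have ec : ∀ x : U, (G x *ᵥ V x) ⬝ᵥ V x = smoothEval x ((h *ᵥ X) ⬝ᵥ X) := fun x => by
    simp only [dotProduct, mulVec, map_sum, map_mul]; rfl
  rw [pd_eq_smoothEval ec,
    deriv_normSq_parallel (isLevi_levi hsym smoothPd_comm hu) hpar', map_zero]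

/-- The Cotton tensor, in coordinates, of a metric `G` such that `e^{2f} G` has a parallel
vector field `V` without zeros. -/
theorem exists_cotton_eq {G' : Model 3 → Matrix (Fin 3) (Fin 3) ℝ} {f : Model 3 → ℝ}
    {V : Model 3 → Fin 3 → ℝ} (hG' : ∀ i j, ContDiffOn ℝ ∞ (fun x => G' x i j) U)
    (hf : ContDiffOn ℝ ∞ f U) (hV : ∀ i, ContDiffOn ℝ ∞ (fun x => V x i) U)
    (hs : ∀ x : U, (G' x)ᵀ = G' x) (hdet : ∀ x : U, (G' x).det ≠ 0)
    (hc : ∀ x : U, (G' x *ᵥ V x) ⬝ᵥ V x ≠ 0)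
    (hGG : ∀ x : U, G' x = Real.exp (2 * f x) • G x)
    (hpar : ∀ (x : U) (i k : Fin 3),
      pd i (fun y => V y k) x + ∑ j, christoffel G' k i j x * V x j = 0) (x : U) :
    ∃ (κ : Fin 3 → ℝ) (r : ℝ), V x ⬝ᵥ κ = 0 ∧ ((G' x *ᵥ V x) ⬝ᵥ V x) * r = 1 ∧
      ∀ i j k, cotton G i j k x
        = κ i * (1 / 2 * G' x j k - r * (G' x *ᵥ V x) j * (G' x *ᵥ V x) k)
          - κ j * (1 / 2 * G' x i k - r * (G' x *ᵥ V x) i * (G' x *ᵥ V x) k) := by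
  set h : Matrix (Fin 3) (Fin 3) (smoothFun U) := of fun i j => smoothFun.of (hG' i j) with hh
  set X : Fin 3 → smoothFun U := fun i => smoothFun.of (hV i) with hX
  have eh : ∀ (x : U) i j, G' x i j = smoothEval x (h i j) := fun x i j => rfl
  have eX : ∀ (x : U) i, V x i = smoothEval x (X i) := fun x i => rfl
  have eξ : ∀ (x : U) i, (G' x *ᵥ V x) i = smoothEval x ((h *ᵥ X) i) := fun x i => by
    simp only [mulVec, dotProduct, map_sum, map_mul, eh, eX]
  have ec : ∀ x : U, (G' x *ᵥ V x) ⬝ᵥ V x = smoothEval x ((h *ᵥ X) ⬝ᵥ X) := fun x => by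
    simp only [dotProduct, map_sum, map_mul, eξ, eX]
  obtain ⟨hsym, hu, hpar'⟩ := parallel_lift hG' hV hs hdet hpar
  obtain ⟨ci, hci⟩ := smoothFun.exists_inv ((h *ᵥ X) ⬝ᵥ X) fun x => by
    rw [← smoothEval_apply, ← ec]; exact hc x
  -- The base metric is `G'`, which carries the parallel field, and `G = e^{-2f} G'`; hence the
  -- conformal exponent is `-f`.
  set φ : smoothFun U := smoothFun.of hf.neg with hφ
  have cw : ContDiffOn ℝ ∞ (fun x => Real.exp (2 * -f x)) U := (contDiffOn_const.mul hf.neg).exp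
  have cwi : ContDiffOn ℝ ∞ (fun x => Real.exp (2 * f x)) U := (contDiffOn_const.mul hf).exp
  set w : smoothFun U := smoothFun.of cw with hw
  set wi : smoothFun U := smoothFun.of cwi with hwi
  have hww : w * wi = 1 := by
    ext x
    change Real.exp (2 * -f x) * Real.exp (2 * f x) = 1
    rw [← Real.exp_add]; simp
  have hDw : ∀ i, smoothPd U i w = 2 * w * smoothPd U i φ := fun i => by
    ext x
    have h1 : pd i (fun x => Real.exp (2 * -f x)) x = (smoothPd U i w).1 x :=
      pd_eq_smoothPd (fun _ => rfl) i x
    have h2 : pd i (-f) x = (smoothPd U i φ).1 x := pd_eq_smoothPd (fun _ => rfl) i x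
    have hd : DifferentiableAt ℝ (-f) x :=
      (hf.neg.contDiffAt (U.2.mem_nhds x.2)).differentiableAt (by simp)
    have h3 : HasFDerivAt (fun x => Real.exp (2 * -f x))
        (Real.exp (2 * -f x) • ((2 : ℝ) • fderiv ℝ (-f) x)) x :=
      (hd.hasFDerivAt.const_mul 2).exp
    change (smoothPd U i w).1 x = 2 * Real.exp (2 * -f x) * (smoothPd U i φ).1 x
    rw [← h1, ← h2, pd, h3.fderiv, pd]
    simp only [_root_.smul_apply, smul_eq_mul]
    ring
  obtain ⟨K, hK, hcot⟩ := exists_covExt_schForm hsym smoothPd_comm hu hpar' hci hww hDw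
  have eG : ∀ (x : U) i j, G x i j = smoothEval x ((w • h) i j) := fun x i j => by
    rw [Matrix.smul_apply, smul_eq_mul, map_mul, ← eh, hGG]
    change _ = Real.exp (2 * -f x) * (Real.exp (2 * f x) * G x i j)
    rw [← mul_assoc, ← Real.exp_add]; simp
  have hsw : (w • h)ᵀ = w • h := by rw [transpose_smul, hsym]
  have huw : (w • h) * (wi • h⁻¹) = 1 := by
    rw [Matrix.smul_mul, Matrix.mul_smul, hu, smul_smul, hww, one_smul]
  refine ⟨fun a => smoothEval x (smoothPd U a K), smoothEval x ci, ?_, ?_, fun i j k => ?_⟩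
  · have := congrArg (smoothEval x) hK
    simp only [map_sum, map_mul, map_zero] at this
    exact this
  · have := congrArg (smoothEval x) hci
    rwa [map_mul, ← ec, map_one] at this
  · rw [cotton_eq_smoothEval hsw huw eG, hcot]
    simp only [eh, eξ, splitForm, Pi.sub_apply, Pi.smul_apply, smul_eq_mul, map_sub, map_mul,
      smoothEval_half]
    rfl

end Transfer

/-! ### Pointwise algebra of the Cotton–York tensor. -/

section Pointwise

open Matrix

lemma det_eq_sum_perm (a b c : Fin 3 → ℝ) :
    (of ![a, b, c]).det = ∑ σ : Equiv.Perm (Fin 3),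
      a (σ 0) * b (σ 1) * c (σ 2) * ((Equiv.Perm.sign σ : ℤ) : ℝ) := by
  rw [← det_transpose, det_apply']
  refine Finset.sum_congr rfl fun σ _ => ?_
  simp only [Fin.prod_univ_three, transpose_apply, of_apply]
  simp [mul_comm]

/-- If the Cotton tensor contracted with `a` is `κ ∧ α`, then `CY(a, b)` is `κ ∧ α ∧ b♭` divided by
the volume form. The factor `1 / 2` offsets the two equal terms of the wedge. -/
lemma sum_cottonYorkCoeff {G : Model 3 → Matrix (Fin 3) (Fin 3) ℝ} {x : Model 3}
    {κ α a b : Fin 3 → ℝ} (h : ∀ i j, ∑ k, cotton G i j k x * a k = κ i * α j - κ j * α i) :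
    ∑ i, ∑ j, cottonYorkCoeff G i j x * a i * b j
      = (of ![κ, α, b ᵥ* G x]).det / √(G x).det := by
  have h1 : ∑ i, ∑ j, cottonYorkCoeff G i j x * a i * b j
      = (1 / 2) * ∑ σ : Equiv.Perm (Fin 3), (∑ k, cotton G (σ 0) (σ 1) k x * a k)
        * (b ᵥ* G x) (σ 2) * ((Equiv.Perm.sign σ : ℤ) : ℝ) / √(G x).det := by
    simp only [cottonYorkCoeff, vecMul, dotProduct, Fin.sum_univ_three, Finset.mul_sum,
      Finset.sum_mul, ← Finset.sum_add_distrib]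
    exact Finset.sum_congr rfl fun σ _ => by ring
  have h2 : (of ![α, κ, b ᵥ* G x]).det = - (of ![κ, α, b ᵥ* G x]).det := by
    simp [det_fin_three]; ring
  have h3 : ∑ σ : Equiv.Perm (Fin 3), (∑ k, cotton G (σ 0) (σ 1) k x * a k)
        * (b ᵥ* G x) (σ 2) * ((Equiv.Perm.sign σ : ℤ) : ℝ)
      = (of ![κ, α, b ᵥ* G x]).det - (of ![α, κ, b ᵥ* G x]).det := by
    rw [det_eq_sum_perm, det_eq_sum_perm, ← Finset.sum_sub_distrib]
    refine Finset.sum_congr rfl fun σ _ => ?_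
    rw [h]; ring
  rw [h1, ← Finset.sum_div, h3, h2]
  ring

/-- The algebraic form of the Cotton–York tensor of a metric `G` conformal to one with a parallel
vector field. -/
theorem cottonYorkCoeff_vanishing {G : Model 3 → Matrix (Fin 3) (Fin 3) ℝ}
    {H : Matrix (Fin 3) (Fin 3) ℝ} {V κ : Fin 3 → ℝ} {r μ : ℝ} {x : Model 3} (hH : Hᵀ = H)
    (hGH : H = μ • G x) (hV : V ⬝ᵥ κ = 0) (hr : ((H *ᵥ V) ⬝ᵥ V) * r = 1)
    (hC : ∀ i j k, cotton G i j k x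
        = κ i * (1 / 2 * H j k - r * (H *ᵥ V) j * (H *ᵥ V) k)
          - κ j * (1 / 2 * H i k - r * (H *ᵥ V) i * (H *ᵥ V) k)) :
    ∑ i, ∑ j, cottonYorkCoeff G i j x * V i * V j = 0 ∧
    ∀ a b : Fin 3 → ℝ, (H *ᵥ a) ⬝ᵥ V = 0 → (H *ᵥ b) ⬝ᵥ V = 0 →
      ∑ i, ∑ j, cottonYorkCoeff G i j x * a i * b j = 0 := by
  have hμ : μ ≠ 0 := by
    rintro rfl
    rw [hGH] at hr
    simp at hr
  have hV0 : V ≠ 0 := by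
    rintro rfl
    simp at hr
  have hvec : ∀ b, μ • (b ᵥ* G x) = H *ᵥ b := fun b => by
    rw [← vecMul_smul, ← hGH, ← mulVec_transpose, hH]
  have hsum : ∀ a i j, ∑ k, cotton G i j k x * a k
      = κ i * (1 / 2 * (H *ᵥ a) j - r * (H *ᵥ V) j * ((H *ᵥ V) ⬝ᵥ a))
        - κ j * (1 / 2 * (H *ᵥ a) i - r * (H *ᵥ V) i * ((H *ᵥ V) ⬝ᵥ a)) := fun a i j => by
    simp only [hC]
    generalize H *ᵥ V = ξ
    simp only [mulVec, dotProduct, Fin.sum_univ_three]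
    ring
  refine ⟨?_, fun a b ha hb => ?_⟩
  · rw [sum_cottonYorkCoeff (hsum V)]
    -- The coefficient is `1/2 - 1 = -1/2`, since `r` inverts the squared length of `V`; two rows of
    -- the determinant are then proportional.
    have hα : (fun j => 1 / 2 * (H *ᵥ V) j - r * (H *ᵥ V) j * ((H *ᵥ V) ⬝ᵥ V))
        = (-(1 / 2) * μ) • (V ᵥ* G x) := by
      ext j
      rw [mul_smul, hvec, Pi.smul_apply, smul_eq_mul]
      linear_combination (-(H *ᵥ V) j) * hr
    rw [hα]
    have hdet : ∀ (t : ℝ) (β : Fin 3 → ℝ), (of ![κ, t • β, β]).det = 0 := fun t β => by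
      simp [det_fin_three]; ring
    rw [hdet, zero_div]
  · have hswap : (H *ᵥ V) ⬝ᵥ a = 0 := by
      rw [← ha, dotProduct_comm, dotProduct_mulVec, ← mulVec_transpose, hH]
    rw [sum_cottonYorkCoeff (hsum a), div_eq_zero_iff]
    left
    -- All three rows annihilate `V`, so the determinant vanishes.
    rw [← exists_mulVec_eq_zero_iff]
    refine ⟨V, hV0, ?_⟩
    have hb' : (b ᵥ* G x) ⬝ᵥ V = 0 := by
      have : μ * ((b ᵥ* G x) ⬝ᵥ V) = 0 := by rw [← smul_eq_mul, ← smul_dotProduct, hvec, hb]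
      exact (mul_eq_zero.mp this).resolve_left hμ
    have ha' : (fun j => 1 / 2 * (H *ᵥ a) j - r * (H *ᵥ V) j * ((H *ᵥ V) ⬝ᵥ a)) ⬝ᵥ V = 0 := by
      have : (fun j => 1 / 2 * (H *ᵥ a) j - r * (H *ᵥ V) j * ((H *ᵥ V) ⬝ᵥ a))
          = (1 / 2 : ℝ) • (H *ᵥ a) := by ext j; simp [hswap]
      rw [this, smul_dotProduct, ha, smul_zero]
    ext i
    fin_cases i
    · exact (dotProduct_comm _ _).trans hV
    · exact ha'
    · exact hb'

end Pointwise

/-! ### Metrics and vector fields read in a chart. -/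

section Charts

open Matrix Bundle

variable {n : ℕ} {M : Type*} [TopologicalSpace M] [ChartedSpace (Model n) M]
  {e : OpenPartialHomeomorph M (Model n)}

lemma mdifferentiable_of_mem_maximalAtlas
    (he : e ∈ IsManifold.maximalAtlas 𝓘(ℝ, Model n) ∞ M) :
    e.MDifferentiable 𝓘(ℝ, Model n) 𝓘(ℝ, Model n) :=
  ⟨(contMDiffOn_of_mem_maximalAtlas he).mdifferentiableOn (by simp),
    (contMDiffOn_symm_of_mem_maximalAtlas he).mdifferentiableOn (by simp)⟩

lemma map_eq_sum_single {W : Type*} [NormedAddCommGroup W] [NormedSpace ℝ W]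
    (L : Model n →L[ℝ] W) (a : Model n) :
    L a = ∑ i, a i • L (EuclideanSpace.single i 1) := by
  have h : a = ∑ i, a i • (EuclideanSpace.single i (1 : ℝ) : Model n) := by
    ext k
    simp [Pi.single_apply]
  conv_lhs => rw [h, map_sum]
  exact Finset.sum_congr rfl fun i _ => map_smul _ _ _

lemma sum_coordOf_smul_coordVec (he : e ∈ IsManifold.maximalAtlas 𝓘(ℝ, Model n) ∞ M) {x : Model n}
    (hx : x ∈ e.target) (v : TangentSpace 𝓘(ℝ, Model n) (e.symm x)) :
    ∑ i, coordOf e (e.symm x) v i • coordVec e x i = v := by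
  have h1 := (mdifferentiable_of_mem_maximalAtlas he).symm_comp_deriv (e.map_target hx)
  rw [e.right_inv hx] at h1
  have h2 : mfderiv 𝓘(ℝ, Model n) 𝓘(ℝ, Model n) e.symm x (coordOf e (e.symm x) v) = v :=
    congrArg (fun L => L v) h1
  exact (map_eq_sum_single (W := Model n)
    (mfderiv 𝓘(ℝ, Model n) 𝓘(ℝ, Model n) e.symm x) (coordOf e (e.symm x) v)).symm.trans h2

variable [IsManifold 𝓘(ℝ, Model n) ∞ M]

lemma inner_eq_dotProduct (g : SmoothMetric n M)
    (he : e ∈ IsManifold.maximalAtlas 𝓘(ℝ, Model n) ∞ M) {x : Model n} (hx : x ∈ e.target)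
    (v w : TangentSpace 𝓘(ℝ, Model n) (e.symm x)) :
    g.inner (e.symm x) v w = (metricMatrix g e x *ᵥ (coordOf e (e.symm x) v).ofLp) ⬝ᵥ
      (coordOf e (e.symm x) w).ofLp := by
  conv_lhs => rw [← sum_coordOf_smul_coordVec he hx v, ← sum_coordOf_smul_coordVec he hx w]
  simp only [map_sum, map_smul, _root_.sum_apply, _root_.smul_apply, smul_eq_mul, mulVec,
    dotProduct, Finset.sum_mul, Finset.mul_sum]
  refine Finset.sum_congr rfl fun i _ => Finset.sum_congr rfl fun j _ => ?_
  rw [show metricMatrix g e x i j = g.inner (e.symm x) (coordVec e x i) (coordVec e x j) from rfl,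
    g.symm]
  ring

lemma metricMatrix_transpose (g : SmoothMetric n M) (x : Model n) :
    (metricMatrix g e x)ᵀ = metricMatrix g e x := by
  ext i j
  exact g.symm _ _ _

/-- A kernel vector of the matrix would be the coordinates of a tangent vector of zero length,
contradicting positivity. -/
lemma det_metricMatrix_ne_zero (g : SmoothMetric n M)
    (he : e ∈ IsManifold.maximalAtlas 𝓘(ℝ, Model n) ∞ M) {x : Model n} (hx : x ∈ e.target) :
    (metricMatrix g e x).det ≠ 0 := by
  intro h0
  obtain ⟨a, ha, h1⟩ := exists_mulVec_eq_zero_iff.mpr h0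
  set v : TangentSpace 𝓘(ℝ, Model n) (e.symm x) :=
    mfderiv 𝓘(ℝ, Model n) 𝓘(ℝ, Model n) e.symm x (WithLp.toLp 2 a : Model n) with hv
  have hc : coordOf e (e.symm x) v = WithLp.toLp 2 a := by
    have := (mdifferentiable_of_mem_maximalAtlas he).comp_symm_deriv hx
    exact congrArg (fun L => L (WithLp.toLp 2 a : Model n)) this
  have h2 : g.inner (e.symm x) v v = 0 := by
    rw [inner_eq_dotProduct g he hx, hc, h1, zero_dotProduct]
  by_cases hv0 : v = 0
  · rw [hv0] at hc
    have : coordOf e (e.symm x) 0 = 0 := map_zero _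
    rw [this] at hc
    apply ha
    rw [← WithLp.ofLp_toLp 2 a, ← hc]; rfl
  · exact (g.pos _ v hv0).ne' h2

/-- The coordinate field is the image of a constant field under the tangent map of `e.symm`. -/
lemma contMDiffOn_coordVec (he : e ∈ IsManifold.maximalAtlas 𝓘(ℝ, Model n) ∞ M) (i : Fin n) :
    ContMDiffOn 𝓘(ℝ, Model n) 𝓘(ℝ, Model n).tangent ∞
      (fun x => (⟨e.symm x, coordVec e x i⟩ : TangentBundle 𝓘(ℝ, Model n) M)) e.target := by
  have h1 := (contMDiffOn_symm_of_mem_maximalAtlas he).contMDiffOn_tangentMapWithin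
    (m := ∞) (by simp) e.open_target.uniqueMDiffOn
  have h2 : ContMDiffOn 𝓘(ℝ, Model n) 𝓘(ℝ, Model n).tangent ∞
      (fun x : Model n => (⟨x, (EuclideanSpace.single i (1 : ℝ) : Model n)⟩ :
        TangentBundle 𝓘(ℝ, Model n) (Model n))) e.target :=
    contMDiffOn_vectorSpace_iff_contDiffOn.mpr contDiffOn_const
  refine (h1.comp h2 fun x hx => hx).congr fun x hx => ?_
  simp only [Function.comp, tangentMapWithin, coordVec]
  rw [mfderivWithin_of_isOpen e.open_target hx]

lemma contDiffOn_metricMatrix (g : SmoothMetric n M)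
    (he : e ∈ IsManifold.maximalAtlas 𝓘(ℝ, Model n) ∞ M) (i j : Fin n) :
    ContDiffOn ℝ ∞ (fun x => metricMatrix g e x i j) e.target := by
  rw [← contMDiffOn_iff_contDiffOn]
  intro x hx
  have hb := (contMDiffOn_symm_of_mem_maximalAtlas he) x hx
  have : ContMDiffWithinAt 𝓘(ℝ, Model n) (𝓘(ℝ, Model n).prod 𝓘(ℝ)) ∞
      (fun m ↦ TotalSpace.mk' ℝ (E := Bundle.Trivial M ℝ) (e.symm m)
        (g.inner (e.symm m) (coordVec e m i) (coordVec e m j))) e.target x := by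
    apply ContMDiffWithinAt.clm_bundle_apply₂ (F₁ := Model n) (F₂ := Model n)
    · exact ContMDiffAt.comp_contMDiffWithinAt x g.contMDiff.contMDiffAt hb
    · exact contMDiffOn_coordVec he i x hx
    · exact contMDiffOn_coordVec he j x hx
  simp only [contMDiffWithinAt_totalSpace] at this
  exact this.2

lemma contDiffOn_coordOf (he : e ∈ IsManifold.maximalAtlas 𝓘(ℝ, Model n) ∞ M)
    {X : ∀ p : M, TangentSpace 𝓘(ℝ, Model n) p}
    (hX : ContMDiff 𝓘(ℝ, Model n) 𝓘(ℝ, Model n).tangent ∞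
      (fun p => (⟨p, X p⟩ : TangentBundle 𝓘(ℝ, Model n) M))) (k : Fin n) :
    ContDiffOn ℝ ∞ (fun y => coordOf e (e.symm y) (X (e.symm y)) k) e.target := by
  have h1 := (contMDiffOn_of_mem_maximalAtlas he).contMDiffOn_tangentMapWithin
    (m := ∞) (by simp) e.open_source.uniqueMDiffOn
  have h2 := (h1.comp (hX.contMDiffOn (s := e.source)) fun x hx => hx).comp
    (contMDiffOn_symm_of_mem_maximalAtlas he) fun x hx => e.map_target hx
  have h3 := (contMDiff_snd_tangentBundle_modelSpace (Model n) 𝓘(ℝ, Model n)).comp_contMDiffOn h2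
  rw [contMDiffOn_iff_contDiffOn] at h3
  have h4 : ContDiffOn ℝ ∞ (fun y => coordOf e (e.symm y) (X (e.symm y))) e.target := by
    refine h3.congr fun x hx => ?_
    simp only [Function.comp, tangentMapWithin, coordOf]
    rw [mfderivWithin_of_isOpen e.open_source (e.map_target hx)]
  exact contDiffOn_euclidean.mp h4 k

lemma fderiv_eq_zero_of_pd {F : Model n → ℝ} {x : Model n} (h : ∀ i, pd i F x = 0) :
    fderiv ℝ F x = 0 := by
  ext v
  rw [map_eq_sum_single]
  exact Finset.sum_eq_zero fun i _ => (congrArg _ (h i)).trans (smul_zero _)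

end Charts

/-! ### Nonvanishing of a parallel field. -/

section Parallel

open Matrix

variable {M : Type*} [TopologicalSpace M] [ChartedSpace (Model 3) M]
  [IsManifold 𝓘(ℝ, Model 3) ∞ M] {g : SmoothMetric 3 M} {X : ∀ p : M, TangentSpace 𝓘(ℝ, Model 3) p}

lemma isLocallyConstant_normSq (hX : IsParallel g X) :
    IsLocallyConstant fun p => g.inner p (X p) (X p) := by
  rw [IsLocallyConstant.iff_eventually_eq]
  intro p
  set e := chartAt (Model 3) p
  have he : e ∈ IsManifold.maximalAtlas 𝓘(ℝ, Model 3) ∞ M := IsManifold.chart_mem_maximalAtlas p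
  have hp : p ∈ e.source := mem_chart_source _ p
  set V : Model 3 → Fin 3 → ℝ := fun y => (coordOf e (e.symm y) (X (e.symm y))).ofLp
  set F : Model 3 → ℝ := fun y => (metricMatrix g e y *ᵥ V y) ⬝ᵥ V y with hF
  have hFd : ContDiffOn ℝ ∞ F e.target := by
    have h1 := contDiffOn_metricMatrix g he
    have h2 : ∀ k, ContDiffOn ℝ ∞ (fun y => V y k) e.target := contDiffOn_coordOf he hX.1
    simp only [hF, dotProduct, mulVec]
    exact ContDiffOn.sum fun i _ => (ContDiffOn.sum fun j _ => (h1 i j).mul (h2 j)).mul (h2 i)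
  have hF0 : ∀ y ∈ e.target, fderiv ℝ F y = 0 := fun y hy =>
    fderiv_eq_zero_of_pd fun i => pd_normSq_eq_zero (U := ⟨e.target, e.open_target⟩)
      (contDiffOn_metricMatrix g he) (contDiffOn_coordOf he hX.1)
      (fun x => metricMatrix_transpose g x) (fun x => det_metricMatrix_ne_zero g he x.2)
      (fun x i k => hX.2 e he x x.2 i k) i ⟨y, hy⟩
  -- The chart target may be disconnected, so the vanishing derivative is used on a ball.
  obtain ⟨ε, hε, hball⟩ := Metric.isOpen_iff.mp e.open_target (e p) (e.map_source hp)
  have hconst : ∀ y ∈ Metric.ball (e p) ε, F y = F (e p) := fun y hy =>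
    Metric.isOpen_ball.is_const_of_fderiv_eq_zero (convex_ball _ _).isPreconnected
      ((hFd.differentiableOn (by simp)).mono hball) (fun z hz => hF0 z (hball hz)) hy
      (Metric.mem_ball_self hε)
  have hval : ∀ q ∈ e.source, g.inner q (X q) (X q) = F (e q) := fun q hq => by
    have h1 := inner_eq_dotProduct g he (e.map_source hq) (X (e.symm (e q))) (X (e.symm (e q)))
    have h2 := congrArg (fun q => g.inner q (X q) (X q)) (e.left_inv hq)
    exact h2.symm.trans h1
  filter_upwards [e.open_source.mem_nhds hp,
    (e.continuousAt hp).preimage_mem_nhds (Metric.ball_mem_nhds _ hε)] with q hq hqb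
  rw [hval q hq, hval p hp, hconst _ hqb]

/-- The squared length is constant on each connected component, so nonvanishing at one point spreads
to the whole component. -/
lemma parallel_ne_zero (hX : IsParallel g X)
    (hX0 : ∀ p : M, ∃ q ∈ connectedComponent p, X q ≠ 0) (p : M) : X p ≠ 0 := by
  obtain ⟨q, hq, hXq⟩ := hX0 p
  have h1 : g.inner p (X p) (X p) = g.inner q (X q) (X q) :=
    (isLocallyConstant_normSq hX).apply_eq_of_isPreconnected
      isPreconnected_connectedComponent mem_connectedComponent hq
  intro h0
  have h2 := g.pos q (X q) hXq
  rw [← h1, h0] at h2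
  simp at h2

end Parallel

end ConformalGeom

end

/-! ### The main theorem. -/

open scoped Manifold ContDiff in
open ConformalGeom in
theorem theorem1p5 {M : Type*} [TopologicalSpace M] [ChartedSpace (Model 3) M]
    [IsManifold 𝓘(ℝ, Model 3) ∞ M] (g g' : SmoothMetric 3 M) (hconf : IsConformal g g')
    (X : ∀ p : M, TangentSpace 𝓘(ℝ, Model 3) p) (hX : IsParallel g' X)
    (hX0 : ∀ p : M, ∃ q ∈ connectedComponent p, X q ≠ 0) (p : M) :
    ∃ v : TangentSpace 𝓘(ℝ, Model 3) p, v ≠ 0 ∧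
      ∀ e ∈ IsManifold.maximalAtlas 𝓘(ℝ, Model 3) ∞ M, p ∈ e.source →
        cottonYork g e p v v = 0 ∧
        ∀ w₁ w₂ : TangentSpace 𝓘(ℝ, Model 3) p,
          g.inner p v w₁ = 0 → g.inner p v w₂ = 0 → cottonYork g e p w₁ w₂ = 0 := by
  refine ⟨X p, parallel_ne_zero hX hX0 p, fun e he hp => ?_⟩
  -- Writing `p` as `e.symm x` makes the tangent space at `p` the one in which the coordinate
  -- formulas are stated.
  obtain ⟨x, hx, rfl⟩ : ∃ x ∈ e.target, e.symm x = p := ⟨e p, e.map_source hp, e.left_inv hp⟩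
  obtain ⟨f, hf, hfg⟩ := hconf
  have hGG : ∀ y, metricMatrix g' e y = Real.exp (2 * f (e.symm y)) • metricMatrix g e y :=
    fun y => by ext i j; exact hfg _ _ _
  have hfs : ContDiffOn ℝ ∞ (fun y => f (e.symm y)) e.target :=
    contMDiffOn_iff_contDiffOn.mp
      (hf.comp_contMDiffOn (contMDiffOn_symm_of_mem_maximalAtlas he))
  obtain ⟨κ, r, hκ, hr, hC⟩ := exists_cotton_eq (U := ⟨e.target, e.open_target⟩)
    (G := metricMatrix g e) (V := fun y => (coordOf e (e.symm y) (X (e.symm y))).ofLp)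
    (contDiffOn_metricMatrix g' he) hfs (contDiffOn_coordOf he hX.1)
    (fun y => metricMatrix_transpose g' y) (fun y => det_metricMatrix_ne_zero g' he y.2)
    (fun y => by
      rw [← inner_eq_dotProduct g' he y.2]
      exact (g'.pos _ _ (parallel_ne_zero hX hX0 _)).ne')
    (fun y => hGG y) (fun y i k => hX.2 e he y y.2 i k) ⟨x, hx⟩
  obtain ⟨h1, h2⟩ := cottonYorkCoeff_vanishing (metricMatrix_transpose g' x) (hGG x) hκ hr hC
  -- Orthogonality to `X` is the same for both conformal metrics.
  have key : ∀ w : TangentSpace 𝓘(ℝ, Model 3) (e.symm x), g.inner (e.symm x) (X (e.symm x)) w = 0 →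
      (metricMatrix g' e x).mulVec (coordOf e (e.symm x) w).ofLp ⬝ᵥ
        (coordOf e (e.symm x) (X (e.symm x))).ofLp = 0 := fun w hw => by
    rw [← inner_eq_dotProduct g' he hx, g'.symm, hfg, hw, mul_zero]
  simp only [cottonYork, e.right_inv hx]
  exact ⟨h1, fun w₁ w₂ hw₁ hw₂ => h2 _ _ (key w₁ hw₁) (key w₂ hw₂)⟩
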